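/- Let $n\ge 1$ and let $W:\mathbb R^n\to\mathbb C$ be a function for which there is a real number $\alpha_{\inf}$ such that, with $$G_\alpha(y):=W(y)\,(1+|y|^2)^{-\alpha/2},$$ one has $G_\alpha\in L^1(\mathbb R^n)$ for all $\alpha>\alpha_{\inf}$ and $G_\alpha\notin L^1(\mathbb R^n)$ for all $\alpha<\alpha_{\inf}$. Let $\hat G_\alpha$ denote the Fourier transform of $G_\alpha$ as a tempered distribution, with the normalization $\hat f(p)=\int e^{-2\pi i p\cdot y}f(y)\,dy$. For $\lambda>0$ and a tempered distribution $S$ let $S(\lambda\,\cdot)$ be the rescaled distribution, $\langle S(\lambda\,\cdot),\varphi\rangle=\lambda^{-n}\langle S,\varphi(\cdot/\lambda)\rangle$. Convergence of tempered distributions means convergence after pairing with each Schwartz function. (i) Let $0<\varepsilon<n$. There is a constant $K>0$, depending only on $n$ and $\varepsilon$, such that the following holds for all such $W$. Let $\alpha=\alpha_{\inf}-\varepsilon$ and suppose that $G_\alpha$ has the (non-integrable) tail $c\,|y|^{-(n-\varepsilon)}$ with a constant $c\in\mathbb C\setminus\{0\}$, that is, $|y|^{n-\varepsilon}G_\alpha(y)\to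 c$ as $|y|\to\infty$. Then $G_\alpha$ defines a tempered distribution, and $\hat G_\alpha(p)\sim Kc\,|p|^{-\varepsilon}$ near $p=0$ in the sense of distributions: $$\lambda^{\varepsilon}\,\hat G_\alpha(\lambda\,\cdot)\;\longrightarrow\;Kc\,|\cdot|^{-\varepsilon}\quad\text{in }\mathcal S'(\mathbb R^n)\text{ as }\lambda\downarrow 0 .$$ (ii) There is a constant $K>0$, depending only on $n$, such that the following holds for all such $W$. Let $\alpha=\alpha_{\inf}$ and suppose that $|y|^{n}G_{\alpha}(y)\to c$ as $|y|\to\infty$ with a constant $c\in\mathbb C\setminus\{0\}$. Then $G_\alpha$ defines a tempered distribution, and $\hat G_{\alpha}$ has the logarithmic singularity $-Kc\log|p|$ at $p=0$ in the sense of distributions: there are numbers $b(\lambda)\in\mathbb C$, $\lambda>0$, with $b(\lambda)/\log(1/\lambda)\to Kc$ as $\lambda\downarrow0$ and $$\hat G_{\alpha}(\lambda\,\cdot)-b(\lambda)\;\longrightarrow\;-Kc\,\log|\cdot|\quad\text{in }\mathcal S'(\mathbb R^n)\text{ as }\lambda\downarrow 0 .$$ -/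

import Mathlib

open MeasureTheory Filter Topology
open scoped SchwartzMap FourierTransform

noncomputable section

namespace ScalingLimit

/-- Euclidean space `ℝⁿ`. -/
abbrev Space (n : ℕ) := EuclideanSpace ℝ (Fin n)

/-- `G_α(y) = W(y) (1 + |y|²)^{-α/2}`. -/
def G {n : ℕ} (W : Space n → ℂ) (α : ℝ) (y : Space n) : ℂ :=
  W y * (((1 + ‖y‖ ^ 2) ^ (-α / 2) : ℝ) : ℂ)

/-- `a` is the exponent `α_inf` of `W`: `G_α ∈ L¹` for `α > a` and `G_α ∉ L¹` for `α < a`. -/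
def IsAlphaInf {n : ℕ} (W : Space n → ℂ) (a : ℝ) : Prop :=
  (∀ α : ℝ, a < α → Integrable (G W α)) ∧ (∀ α : ℝ, α < a → ¬ Integrable (G W α))

/-- `g` has the tail `c |y|^{-s}` at infinity: `|y|^s g(y) → c` as `|y| → ∞`. -/
def HasPowerTail {n : ℕ} (g : Space n → ℂ) (s : ℝ) (c : ℂ) : Prop :=
  Tendsto (fun y : Space n => ((‖y‖ ^ s : ℝ) : ℂ) * g y) (cocompact (Space n)) (𝓝 c)

/-- The tempered distribution `T` is the regular distribution given by the function `g`,
all the integrals against Schwartz functions being absolutely convergent. -/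
def IsRegular {n : ℕ} (T : 𝓢'(Space n, ℂ)) (g : Space n → ℂ) : Prop :=
  ∀ φ : 𝓢(Space n, ℂ),
    Integrable (fun y => φ y * g y) ∧ T φ = ∫ y, φ y * g y

/-- Multiplication by `r ≠ 0` as a linear automorphism of `ℝⁿ`. -/
def scaling {n : ℕ} (r : ℝ) (hr : r ≠ 0) : Space n ≃L[ℝ] Space n :=
  ContinuousLinearEquiv.smulLeft (Units.mk0 r hr)

/-- The rescaled distribution `S(r ·)`, `⟨S(r ·), φ⟩ = |r|^{-n} ⟨S, φ(· / r)⟩`, for `r ≠ 0`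
(and `0` by convention for `r = 0`). -/
def dilate {n : ℕ} (r : ℝ) (S : 𝓢'(Space n, ℂ)) : 𝓢'(Space n, ℂ) :=
  if hr : r ≠ 0 then
    (((|r| ^ n)⁻¹ : ℝ) : ℂ) • PointwiseConvergenceCLM.precomp ℂ
      (SchwartzMap.compCLMOfContinuousLinearEquiv ℂ (scaling (n := n) r hr).symm) S
  else 0

theorem dilate_apply {n : ℕ} {r : ℝ} (hr : r ≠ 0) (S : 𝓢'(Space n, ℂ)) (φ : 𝓢(Space n, ℂ)) :
    dilate r S φ = (((|r| ^ n)⁻¹ : ℝ) : ℂ) *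
      S (SchwartzMap.compCLMOfContinuousLinearEquiv ℂ (scaling (n := n) r hr).symm φ) := by
  rw [dilate, dif_pos hr]
  rfl

theorem scaling_symm_apply {n : ℕ} {r : ℝ} (hr : r ≠ 0) (y : Space n) :
    (scaling (n := n) r hr).symm y = r⁻¹ • y := by
  rw [ContinuousLinearEquiv.symm_apply_eq]
  change y = r • r⁻¹ • y
  rw [smul_smul, mul_inv_cancel₀ hr, one_smul]

/-- `S(p) ∼ C |p|^{-ε}` near `p = 0` in the sense of distributions:
`r^ε S(r ·) → C |·|^{-ε}` in the space of tempered distributions as `r ↓ 0`. -/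
def HasPowerSingularity {n : ℕ} (S : 𝓢'(Space n, ℂ)) (ε : ℝ) (C : ℂ) : Prop :=
  ∃ U : 𝓢'(Space n, ℂ),
    IsRegular U (fun p => C * ((‖p‖ ^ (-ε) : ℝ) : ℂ)) ∧
    Tendsto (fun r : ℝ => ((r ^ ε : ℝ) : ℂ) • dilate r S) (𝓝[>] 0) (𝓝 U)

/-- `S` has the logarithmic singularity `-C log |p|` near `p = 0` in the sense of distributions:
`S(r ·) = b(r) - C log |·| + o(1)` in the space of tempered distributions as `r ↓ 0`,
with constants `b(r)` such that `b(r) / log (1/r) → C`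
(`volume.toTemperedDistribution` is the constant function `1` as a distribution). -/
def HasLogSingularity {n : ℕ} (S : 𝓢'(Space n, ℂ)) (C : ℂ) : Prop :=
  ∃ (L : 𝓢'(Space n, ℂ)) (b : ℝ → ℂ),
    IsRegular L (fun p => -C * ((Real.log ‖p‖ : ℝ) : ℂ)) ∧
    Tendsto (fun r : ℝ => b r / ((Real.log r⁻¹ : ℝ) : ℂ)) (𝓝[>] 0) (𝓝 C) ∧
    Tendsto (fun r : ℝ => dilate r S - b r • volume.toTemperedDistribution) (𝓝[>] 0) (𝓝 L)

end ScalingLimit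

end

/-! By duality the rescaled transform is `⟨Ĝ(r ·), φ⟩ = ∫ G(y) φ̂(r y) dy` (`dilate_fourier_apply`),
so the behaviour at `p = 0` is decided by the tail of `G`. Put `x = r y`. With tail exponent `s`,
the integrand `r^{-s} G(x/r) φ̂(x)` tends to `c |x|^{-s} φ̂(x)`, and `tendsto_scaling` justifies the
limit by dominated convergence.

For `s = n - ε` the limit is a Riesz kernel tested against `φ̂`. Writing powers as superpositions of
Gaussians gives its Fourier transform (`integral_rpow_mul_fourier`), with `K = rieszConst n ε`.

For `s = n` the kernel `|x|^{-n}` is not integrable at the origin, so the same limit is available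
only when `φ̂(0) = ∫ φ = 0`. On such test functions, letting `ε → 0` in the Riesz identity produces
`-log |p|` (`integral_rpow_neg_mul_fourier`), with `K = sphereArea n` the limit of `ε * rieszConst n
ε`. A general `φ` is reduced to this case by subtracting `(∫ φ) φ₀` for a fixed `φ₀` of integral
one. The `φ₀` component goes into `b(r)`, whose logarithmic growth is `tendsto_div_log`.

The exponent `α_inf` enters through `IsAlphaInf.exists_weight`, which makes `G` locally integrable
and integrable against a negative power of `1 + |y|`. -/

namespace ScalingLimit

open Metric Set

/-! ### Integrability from power bounds at the origin and at infinity -/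

section Integrability

variable {n : ℕ}

theorem measurable_norm_rpow (s : ℝ) : Measurable (fun x : Space n => ‖x‖ ^ s) :=
  measurable_norm.pow_const s

theorem exists_pow_mul_norm_le (ψ : 𝓢(Space n, ℂ)) (k : ℕ) :
    ∃ C, 0 < C ∧ ∀ x, ‖x‖ ^ k * ‖ψ x‖ ≤ C := by
  obtain ⟨C, hC, h⟩ := ψ.decay k 0
  exact ⟨C, hC, fun x => by simpa using h x⟩

variable [NeZero n]

/-- A radial majorant with exponent `-a` near the origin and `-b` at infinity. -/
theorem integrable_radial_majorant {a b : ℝ} (ha : a < n) (hb : n < b) :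
    Integrable (fun x : Space n => if ‖x‖ ≤ 1 then ‖x‖ ^ (-a) else ‖x‖ ^ (-b)) := by
  refine (integrable_fun_norm_addHaar (E := Space n) volume
    (f := fun y : ℝ => if y ≤ 1 then y ^ (-a) else y ^ (-b))).2 ?_
  have hn : 1 ≤ n := NeZero.one_le
  have key : ∀ y : ℝ, 0 < y → ∀ s : ℝ, y ^ (Module.finrank ℝ (Space n) - 1) • y ^ s
      = y ^ ((n : ℝ) - 1 + s) := by
    intro y hy s
    rw [finrank_euclideanSpace_fin, smul_eq_mul, Real.rpow_add hy, ← Real.rpow_natCast,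
      Nat.cast_sub hn, Nat.cast_one]
  rw [← Ioc_union_Ioi_eq_Ioi zero_le_one]
  refine IntegrableOn.union ?_ ?_
  · have h1 : IntegrableOn (fun y : ℝ => y ^ ((n : ℝ) - 1 + -a)) (Ioc 0 1) := by
      rw [← intervalIntegrable_iff_integrableOn_Ioc_of_le zero_le_one]
      exact intervalIntegral.intervalIntegrable_rpow' (by linarith)
    refine h1.congr_fun (fun y hy => ?_) measurableSet_Ioc
    simp only [if_pos hy.2]
    exact (key y hy.1 _).symm
  · have h1 : IntegrableOn (fun y : ℝ => y ^ ((n : ℝ) - 1 + -b)) (Ioi 1) :=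
      integrableOn_Ioi_rpow_of_lt (by linarith) one_pos
    refine h1.congr_fun (fun y hy => ?_) measurableSet_Ioi
    simp only [if_neg (not_le.2 (mem_Ioi.1 hy))]
    exact (key y (one_pos.trans hy) _).symm

theorem ae_ne_zero : ∀ᵐ x : Space n, x ≠ 0 := by
  simp [ae_iff]

theorem integrable_of_norm_le_rpow {E : Type*} [NormedAddCommGroup E] {f : Space n → E}
    (hf : AEStronglyMeasurable f) {a b C : ℝ} (ha : a < n) (hb : n < b)
    (h1 : ∀ x, x ≠ 0 → ‖x‖ ≤ 1 → ‖f x‖ ≤ C * ‖x‖ ^ (-a))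
    (h2 : ∀ x, 1 < ‖x‖ → ‖f x‖ ≤ C * ‖x‖ ^ (-b)) : Integrable f := by
  refine ((integrable_radial_majorant ha hb).const_mul C).mono' hf ?_
  filter_upwards [ae_ne_zero] with x hx
  split_ifs with h
  · exact h1 x hx h
  · exact h2 x (not_le.1 h)

/-- A function that is `O(|x|^{-a})` at the origin, `a < n`, and rapidly decreasing. -/
theorem integrable_of_near_of_decay {E : Type*} [NormedAddCommGroup E] {f : Space n → E}
    (hf : AEStronglyMeasurable f) {a C : ℝ} (ha : a < n)
    (h1 : ∀ x, x ≠ 0 → ‖x‖ ≤ 1 → ‖f x‖ ≤ C * ‖x‖ ^ (-a))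
    (h2 : ∃ D, ∀ x, 1 < ‖x‖ → ‖x‖ ^ (n + 1) * ‖f x‖ ≤ D) : Integrable f := by
  obtain ⟨D, hD⟩ := h2
  refine integrable_of_norm_le_rpow (a := a) (b := n + 1) (C := max C D) hf ha (by linarith) ?_ ?_
  · intro x hx hx1
    refine (h1 x hx hx1).trans ?_
    gcongr
    exact le_max_left _ _
  · intro x hx
    have hx0 : 0 < ‖x‖ := one_pos.trans hx
    have : ‖f x‖ ≤ D * ‖x‖ ^ (-((n : ℝ) + 1)) := by
      rw [Real.rpow_neg hx0.le, ← div_eq_mul_inv, le_div_iff₀ (by positivity), mul_comm]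
      exact_mod_cast hD x hx
    refine this.trans ?_
    gcongr
    exact le_max_right _ _

end Integrability

/-! ### Regular tempered distributions and their dilated Fourier transforms -/

section Regular

variable {n : ℕ}

/-- A function with an integrable polynomially weighted modulus defines a tempered
distribution. -/
theorem exists_isRegular {g : Space n → ℂ} (hg : AEStronglyMeasurable g) (k : ℕ)
    (h : Integrable (fun y => ((1 + ‖y‖) ^ k)⁻¹ * ‖g y‖)) :
    ∃ T : 𝓢'(Space n, ℂ), IsRegular T g := by
  have hbd : ∀ (φ : 𝓢(Space n, ℂ)) (y : Space n), ‖φ y * g y‖ ≤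
      2 ^ k * (Finset.Iic (k, 0)).sup (schwartzSeminormFamily ℂ (Space n) ℂ) φ *
        (((1 + ‖y‖) ^ k)⁻¹ * ‖g y‖) := by
    intro φ y
    have h1 := SchwartzMap.one_add_le_sup_seminorm_apply (𝕜 := ℂ) (m := (k, 0)) le_rfl le_rfl φ y
    rw [norm_iteratedFDeriv_zero] at h1
    have h2 : 0 < (1 + ‖y‖) ^ k := by positivity
    rw [norm_mul, ← mul_assoc]
    gcongr
    rw [← div_eq_mul_inv, le_div_iff₀ h2, mul_comm]
    exact h1
  have hint : ∀ φ : 𝓢(Space n, ℂ), Integrable (fun y => φ y * g y) := fun φ =>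
    (h.const_mul _).mono' (φ.continuous.aestronglyMeasurable.mul hg) (.of_forall (hbd φ))
  let A : 𝓢(Space n, ℂ) →L[ℂ] ℂ := SchwartzMap.mkCLMtoNormedSpace (𝕜 := ℂ) (σ := RingHom.id ℂ)
    (fun φ => ∫ y, φ y * g y)
    (fun φ ψ => by
      simp only [add_apply, add_mul]
      exact integral_add (hint φ) (hint ψ))
    (fun a φ => by
      simp only [smul_apply, smul_eq_mul, mul_assoc, RingHom.id_apply]
      exact integral_const_mul _ _)
    ⟨Finset.Iic (k, 0), 2 ^ k * ∫ y, ((1 + ‖y‖) ^ k)⁻¹ * ‖g y‖, by positivity, fun φ => by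
      refine (norm_integral_le_of_norm_le (h.const_mul _) (.of_forall (hbd φ))).trans_eq ?_
      rw [integral_const_mul]
      ring⟩
  exact ⟨A.toPointwiseConvergenceCLM ℂ _ _ _, fun φ => ⟨hint φ, rfl⟩⟩

/-- Dilating the Fourier transform of a regular distribution. -/
theorem dilate_fourier_apply {T : 𝓢'(Space n, ℂ)} {g : Space n → ℂ} (hT : IsRegular T g)
    {r : ℝ} (hr : 0 < r) (φ : 𝓢(Space n, ℂ)) :
    dilate r (𝓕 T) φ = ∫ y, g y * (𝓕 φ) (r • y) := by
  rw [dilate_apply hr.ne', TemperedDistribution.fourier_apply, (hT _).2, ← integral_const_mul]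
  congr 1 with y
  -- The transform of `φ(·/r)` is `r^n φ̂(r ·)`; this `r^n` cancels the normalization in `dilate`.
  have : (𝓕 (SchwartzMap.compCLMOfContinuousLinearEquiv ℂ (scaling (n := n) r hr.ne').symm φ)) y
      = ((r ^ n : ℝ) : ℂ) * (𝓕 φ) (r • y) := by
    rw [SchwartzMap.fourier_coe, SchwartzMap.fourier_coe, Real.fourier_eq, Real.fourier_eq]
    have := Measure.integral_comp_smul (volume : Measure (Space n))
      (fun v => Real.fourierChar (-inner ℝ v (r • y)) • φ v) r⁻¹
    rw [finrank_euclideanSpace_fin, inv_pow, inv_inv, abs_of_pos (by positivity)] at this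
    rw [← Complex.real_smul, ← this]
    congr 1 with v
    rw [SchwartzMap.compCLMOfContinuousLinearEquiv_apply, Function.comp_apply, scaling_symm_apply,
      inner_smul_left, inner_smul_right]
    simp [hr.ne']
  rw [this, abs_of_pos hr]
  have : ((r ^ n : ℝ) : ℂ) ≠ 0 := by exact_mod_cast (pow_pos hr n).ne'
  rw [Complex.ofReal_inv]
  field_simp

end Regular

/-! ### Scaling limits of functions with a power tail -/

section Scaling

variable {n : ℕ}

theorem aestronglyMeasurable_comp_smul {E : Type*} [TopologicalSpace E] {g : Space n → E}
    (hg : AEStronglyMeasurable g) {r : ℝ} (hr : r ≠ 0) :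
    AEStronglyMeasurable (fun y => g (r • y)) := by
  refine hg.comp_quasiMeasurePreserving ⟨measurable_const_smul r, ?_⟩
  rw [Measure.map_addHaar_smul _ hr]
  exact Measure.smul_absolutelyContinuous

/-- The tail bound that a power tail provides outside a ball. -/
theorem HasPowerTail.eventually_norm_sub_le {g : Space n → ℂ} {s : ℝ} {c : ℂ}
    (h : HasPowerTail g s c) {δ : ℝ} (hδ : 0 < δ) :
    ∃ R : ℝ, 1 ≤ R ∧ ∀ y : Space n, R < ‖y‖ →
      ‖g y - c * ((‖y‖ ^ (-s) : ℝ) : ℂ)‖ ≤ δ * ‖y‖ ^ (-s) := by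
  have h1 : ∀ᶠ y in cocompact (Space n), ‖((‖y‖ ^ s : ℝ) : ℂ) * g y - c‖ < δ := by
    filter_upwards [h (ball_mem_nhds c hδ)] with y hy
    simpa [dist_eq_norm] using hy
  obtain ⟨R, hR⟩ := (Metric.hasBasis_cobounded_compl_closedBall (0 : Space n)).eventually_iff.1
    (by rwa [Metric.cobounded_eq_cocompact]) |>.imp fun _ h => h.2
  refine ⟨max R 1, le_max_right _ _, fun y hy => ?_⟩
  have hy0 : 0 < ‖y‖ := by linarith [le_max_right R 1]
  have hyR : y ∈ (closedBall (0 : Space n) R)ᶜ := by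
    simpa using (le_max_left R 1).trans_lt hy
  have := (hR hyR).le
  have e : g y - c * ((‖y‖ ^ (-s) : ℝ) : ℂ) =
      (((‖y‖ ^ s : ℝ) : ℂ) * g y - c) * ((‖y‖ ^ (-s) : ℝ) : ℂ) := by
    have : ((‖y‖ ^ s : ℝ) : ℂ) * ((‖y‖ ^ (-s) : ℝ) : ℂ) = 1 := by
      rw [← Complex.ofReal_mul, ← Real.rpow_add hy0]
      simp
    linear_combination (-g y) * this
  rw [e, norm_mul, Complex.norm_real, Real.norm_of_nonneg (by positivity)]
  gcongr

theorem HasPowerTail.eventually_norm_le {g : Space n → ℂ} {s : ℝ} {c : ℂ}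
    (h : HasPowerTail g s c) :
    ∃ R : ℝ, 1 ≤ R ∧ ∀ y : Space n, R < ‖y‖ → ‖g y‖ ≤ (‖c‖ + 1) * ‖y‖ ^ (-s) := by
  obtain ⟨R, hR1, hR⟩ := h.eventually_norm_sub_le one_pos
  refine ⟨R, hR1, fun y hy => ?_⟩
  have h1 := hR y hy
  have h2 : ‖c * ((‖y‖ ^ (-s) : ℝ) : ℂ)‖ = ‖c‖ * ‖y‖ ^ (-s) := by
    rw [norm_mul, Complex.norm_real, Real.norm_of_nonneg (by positivity)]
  have h3 := norm_le_norm_add_norm_sub' (g y) (c * ((‖y‖ ^ (-s) : ℝ) : ℂ))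
  linarith

theorem integral_comp_smul_eq {E : Type*} [NormedAddCommGroup E] [NormedSpace ℝ E]
    (f : Space n → E) {r : ℝ} (hr : 0 < r) :
    r ^ n • ∫ y, f (r • y) = ∫ x, f x := by
  rw [Measure.integral_comp_smul, finrank_euclideanSpace_fin, smul_smul,
    abs_of_pos (by positivity), mul_inv_cancel₀ (by positivity), one_smul]

/-- The scaling limit of a function with a power tail, tested against `ψ`. -/
theorem tendsto_scaling [NeZero n] {g ψ : Space n → ℂ} {s : ℝ} {c : ℂ} (hgm : AEStronglyMeasurable g)
    (hloc : ∀ R, IntegrableOn g (closedBall 0 R)) (htail : HasPowerTail g s c) (hsn : s ≤ n)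
    (hψ : Continuous ψ) {B : ℝ} (hB : ∀ x, ‖ψ x‖ ≤ B)
    (hint : Integrable (fun x => ((‖x‖ ^ (-s) : ℝ) : ℂ) * ψ x))
    (hz : ∀ y, Tendsto (fun r : ℝ => ((r ^ (n - s) : ℝ) : ℂ) * ψ (r • y)) (𝓝[>] 0) (𝓝 0)) :
    Tendsto (fun r : ℝ => ((r ^ (n - s) : ℝ) : ℂ) * ∫ y, g y * ψ (r • y)) (𝓝[>] 0)
      (𝓝 (c * ∫ x, ((‖x‖ ^ (-s) : ℝ) : ℂ) * ψ x)) := by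
  obtain ⟨R, hR1, hR⟩ := htail.eventually_norm_le
  have hr1 : ∀ᶠ r : ℝ in 𝓝[>] 0, 0 < r ∧ r < 1 := Ioo_mem_nhdsGT one_pos
  have hB0 : 0 ≤ B := (norm_nonneg _).trans (hB 0)
  -- the ball
  have hball : Tendsto (fun r : ℝ => ∫ y in closedBall (0 : Space n) R,
      ((r ^ (n - s) : ℝ) : ℂ) * (g y * ψ (r • y))) (𝓝[>] 0) (𝓝 0) := by
    have := tendsto_integral_filter_of_dominated_convergence
      (μ := volume.restrict (closedBall (0 : Space n) R)) (l := 𝓝[>] (0 : ℝ))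
      (F := fun r y => ((r ^ (n - s) : ℝ) : ℂ) * (g y * ψ (r • y))) (f := fun _ => 0)
      (fun y => ‖g y‖ * B)
      (.of_forall fun r => ((hgm.restrict.mul
        (by fun_prop : Continuous fun y => ψ (r • y)).aestronglyMeasurable).const_mul _))
      (hr1.mono fun r hr => .of_forall fun y => by
        rw [norm_mul, norm_mul, Complex.norm_real, Real.norm_of_nonneg (by positivity [hr.1])]
        calc r ^ (n - s) * (‖g y‖ * ‖ψ (r • y)‖) ≤ 1 * (‖g y‖ * B) := by
              gcongr
              · exact Real.rpow_le_one hr.1.le hr.2.le (by linarith)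
              · exact hB _
          _ = _ := one_mul _)
      ((hloc R).norm.mul_const B)
      -- The hypothesis `hz` covers two regimes: for `s < n` the prefactor `r^(n-s)` vanishes, while
      -- for `s = n` it is one and `ψ` must vanish at the origin.
      (.of_forall fun y => by
        have := (hz y).const_mul (g y)
        rw [mul_zero] at this
        exact this.congr fun r => by ring)
    simpa using this
  -- the complement of the ball, rescaled
  let F : ℝ → Space n → ℂ := fun r =>
    ({x | R < ‖r⁻¹ • x‖}).indicator fun x => ((r ^ (-s) : ℝ) : ℂ) * g (r⁻¹ • x) * ψ x
  have hFmeas : ∀ r : ℝ, 0 < r → AEStronglyMeasurable (F r) := fun r hr => by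
    refine AEStronglyMeasurable.indicator ?_
      (measurableSet_lt measurable_const (by fun_prop))
    exact ((aestronglyMeasurable_comp_smul hgm (inv_ne_zero hr.ne')).const_mul _).mul
      hψ.aestronglyMeasurable
  -- The tail bound is homogeneous of the same degree as the scaling factor, so all powers of `r`
  -- cancel and the majorant is uniform.
  have hFbd : ∀ r : ℝ, 0 < r → ∀ x, ‖F r x‖ ≤ (‖c‖ + 1) * ‖((‖x‖ ^ (-s) : ℝ) : ℂ) * ψ x‖ := by
    intro r hr x
    by_cases hx : R < ‖r⁻¹ • x‖
    · have h1 := hR _ hx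
      rw [norm_smul, norm_inv, Real.norm_of_nonneg hr.le,
        Real.mul_rpow (by positivity) (by positivity), Real.inv_rpow hr.le] at h1
      simp only [F, indicator_of_mem (s := {x | R < ‖r⁻¹ • x‖}) hx]
      rw [norm_mul, norm_mul, norm_mul, Complex.norm_real, Complex.norm_real,
        Real.norm_of_nonneg (by positivity), Real.norm_of_nonneg (by positivity)]
      have h2 : 0 < r ^ (-s) := by positivity
      calc r ^ (-s) * ‖g (r⁻¹ • x)‖ * ‖ψ x‖
          ≤ r ^ (-s) * ((‖c‖ + 1) * ((r ^ (-s))⁻¹ * ‖x‖ ^ (-s))) * ‖ψ x‖ := by gcongr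
        _ = _ := by field_simp
    · simp only [F, indicator_of_notMem (s := {x | R < ‖r⁻¹ • x‖}) hx, norm_zero]
      positivity
  have hFlim : ∀ x : Space n, x ≠ 0 → Tendsto (fun r => F r x) (𝓝[>] 0)
      (𝓝 (c * (((‖x‖ ^ (-s) : ℝ) : ℂ) * ψ x))) := by
    intro x hx
    have hx0 : 0 < ‖x‖ := norm_pos_iff.2 hx
    have hn : Tendsto (fun r : ℝ => ‖r⁻¹ • x‖) (𝓝[>] 0) atTop := by
      simp only [norm_smul]
      exact (tendsto_norm_atTop_atTop.comp tendsto_inv_nhdsGT_zero).atTop_mul_const hx0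
    have hco : Tendsto (fun r : ℝ => r⁻¹ • x) (𝓝[>] 0) (cocompact (Space n)) := by
      rw [← Metric.cobounded_eq_cocompact, ← tendsto_norm_atTop_iff_cobounded]
      exact hn
    have h1 := ((htail.comp hco).mul_const (((‖x‖ ^ (-s) : ℝ) : ℂ) * ψ x))
    refine h1.congr' ?_
    filter_upwards [hn.eventually_gt_atTop R, hr1] with r hr hr0
    simp only [F, indicator_of_mem (s := {x | R < ‖r⁻¹ • x‖}) hr, Function.comp_apply]
    have e : ‖r⁻¹ • x‖ ^ s * ‖x‖ ^ (-s) = r ^ (-s) := by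
      have := Real.rpow_pos_of_pos hx0 s
      rw [norm_smul, norm_inv, Real.norm_of_nonneg hr0.1.le,
        Real.mul_rpow (by positivity [hr0.1]) (by positivity), Real.inv_rpow hr0.1.le,
        Real.rpow_neg hr0.1.le, Real.rpow_neg hx0.le]
      field_simp
    rw [← e]
    push_cast
    ring
  have houter : Tendsto (fun r : ℝ => ∫ x, F r x) (𝓝[>] 0)
      (𝓝 (∫ x, c * (((‖x‖ ^ (-s) : ℝ) : ℂ) * ψ x))) := by
    refine tendsto_integral_filter_of_dominated_convergence _
      (hr1.mono fun r hr => hFmeas r hr.1) (hr1.mono fun r hr => .of_forall (hFbd r hr.1))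
      (hint.norm.const_mul _) ?_
    filter_upwards [ae_ne_zero] with x hx using hFlim x hx
  rw [integral_const_mul] at houter
  have := hball.add houter
  rw [zero_add] at this
  refine this.congr' ?_
  filter_upwards [hr1] with r hr
  have hFr : ∀ y, r ^ n • F r (r • y) = (closedBall (0 : Space n) R)ᶜ.indicator
      (fun y => ((r ^ (n - s) : ℝ) : ℂ) * (g y * ψ (r • y))) y := by
    intro y
    by_cases hy : R < ‖y‖
    · rw [indicator_of_mem (by simpa using hy)]
      simp only [F, smul_smul, inv_mul_cancel₀ hr.1.ne', one_smul, indicator, mem_ofPred_eq, if_pos hy]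
      rw [sub_eq_add_neg, Real.rpow_add hr.1, Real.rpow_natCast, Complex.real_smul]
      push_cast
      ring
    · rw [indicator_of_notMem (by simpa using hy)]
      simp only [F, smul_smul, inv_mul_cancel₀ hr.1.ne', one_smul, indicator, mem_ofPred_eq, if_neg hy,
        smul_zero]
  have hFint : Integrable (F r) :=
    (hint.norm.const_mul _).mono' (hFmeas r hr.1) (.of_forall (hFbd r hr.1))
  have hmeas : MeasurableSet (closedBall (0 : Space n) R) := measurableSet_closedBall
  have hout : IntegrableOn (fun y => ((r ^ (n - s) : ℝ) : ℂ) * (g y * ψ (r • y)))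
      (closedBall (0 : Space n) R)ᶜ := by
    rw [← integrable_indicator_iff hmeas.compl]
    exact ((hFint.comp_smul hr.1.ne').smul (r ^ n)).congr (.of_forall hFr)
  have hin : IntegrableOn (fun y => ((r ^ (n - s) : ℝ) : ℂ) * (g y * ψ (r • y)))
      (closedBall (0 : Space n) R) := by
    refine Integrable.const_mul ?_ _
    refine ((hloc R).norm.mul_const B).mono' (hgm.restrict.mul
        (by fun_prop : Continuous fun y => ψ (r • y)).aestronglyMeasurable) (.of_forall fun y => ?_)
    rw [norm_mul]
    gcongr
    exact hB _
  have hall : Integrable (fun y => ((r ^ (n - s) : ℝ) : ℂ) * (g y * ψ (r • y))) := by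
    rw [← integrableOn_univ, ← union_compl_self (closedBall (0 : Space n) R)]
    exact hin.union hout
  rw [← integral_const_mul, ← integral_add_compl hmeas hall]
  congr 1
  rw [← integral_indicator hmeas.compl, ← integral_comp_smul_eq _ hr.1, ← integral_smul]
  exact integral_congr_ae (.of_forall hFr)

end Scaling

/-! ### Logarithmic growth for the borderline tail -/

section Logarithm

variable {n : ℕ} [NeZero n]

/-- The area of the unit sphere of `ℝⁿ`. -/
noncomputable def sphereArea (n : ℕ) : ℝ := n * (volume : Measure (Space n)).real (ball 0 1)

/-- In polar coordinates the Jacobian turns `t^{-n}` into `t⁻¹`. -/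
theorem integral_annulus {r : ℝ} (hr : 0 < r) (hr1 : r < 1) :
    ∫ x : Space n, (Ioc r 1).indicator (fun t : ℝ => t ^ (-(n : ℝ))) ‖x‖
      = sphereArea n * Real.log r⁻¹ := by
  have hn : 1 ≤ n := NeZero.one_le
  rw [integral_fun_norm_addHaar, finrank_euclideanSpace_fin, sphereArea, nsmul_eq_mul, smul_eq_mul,
    mul_assoc]
  congr 2
  have : ∀ y : ℝ, y ^ (n - 1) • (Ioc r 1).indicator (fun t : ℝ => t ^ (-(n : ℝ))) y
      = (Ioc r 1).indicator (fun t => t⁻¹) y := by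
    intro y
    by_cases hy : y ∈ Ioc r 1
    · have hy0 : 0 < y := hr.trans hy.1
      rw [indicator_of_mem hy, indicator_of_mem hy, Real.rpow_neg hy0.le, Real.rpow_natCast,
        smul_eq_mul, ← pow_sub_one_mul (NeZero.ne n) y]
      field_simp
    · simp [indicator_of_notMem hy]
  simp_rw [this]
  rw [setIntegral_indicator measurableSet_Ioc, inter_eq_right.2 fun y hy => mem_Ioi.2 (hr.trans hy.1),
    ← intervalIntegral.integral_of_le hr1.le, integral_inv_of_pos hr one_pos, one_div]

/-- After rescaling, the domain is `|x| > r`. Replacing `h` by the indicator of the unit ball gives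
exactly the logarithm, and the difference `D` is integrable over all of space, so its `L¹` norm
bounds the error uniformly in `r`. -/
theorem integral_outside_unit_ball {h : Space n → ℂ} (hm : AEStronglyMeasurable h) {C : ℝ}
    (h1 : ∀ x, ‖h x - 1‖ ≤ C * ‖x‖) (h2 : ∀ x, ‖x‖ * ‖h x‖ ≤ C) :
    ∃ M : ℝ, ∀ r : ℝ, 0 < r → r < 1 →
      Integrable ((closedBall (0 : Space n) 1)ᶜ.indicator
        fun y => ((‖y‖ ^ (-(n : ℝ)) : ℝ) : ℂ) * h (r • y)) ∧
      ‖(∫ y, (closedBall (0 : Space n) 1)ᶜ.indicator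
        (fun y => ((‖y‖ ^ (-(n : ℝ)) : ℝ) : ℂ) * h (r • y)) y)
        - ((sphereArea n * Real.log r⁻¹ : ℝ) : ℂ)‖ ≤ M := by
  let D : Space n → ℂ := fun x =>
    ((‖x‖ ^ (-(n : ℝ)) : ℝ) : ℂ) * (h x - (closedBall (0 : Space n) 1).indicator 1 x)
  have hp : Measurable fun x : Space n => ((‖x‖ ^ (-(n : ℝ)) : ℝ) : ℂ) :=
    Complex.measurable_ofReal.comp (measurable_norm_rpow _)
  have hDm : AEStronglyMeasurable D := by
    refine hp.aestronglyMeasurable.mul (hm.sub ?_)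
    exact aestronglyMeasurable_one.indicator measurableSet_closedBall
  have hD : Integrable D := by
    -- `h1` gains one power of `|x|` at the origin and `h2` one at infinity, which moves both
    -- exponents off the critical value `n`.
    refine integrable_of_norm_le_rpow (a := n - 1) (b := n + 1) (C := C) hDm (by linarith)
      (by linarith) ?_ ?_
    · intro x hx hx1
      have hx0 : 0 < ‖x‖ := norm_pos_iff.2 hx
      simp only [D]
      rw [indicator_of_mem (by simpa using hx1), norm_mul, Complex.norm_real,
        Real.norm_of_nonneg (by positivity), Pi.one_apply]
      calc ‖x‖ ^ (-(n : ℝ)) * ‖h x - 1‖ ≤ ‖x‖ ^ (-(n : ℝ)) * (C * ‖x‖) := by gcongr; exact h1 x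
        _ = C * ‖x‖ ^ (-((n : ℝ) - 1)) := by
          rw [show -((n : ℝ) - 1) = -n + 1 by ring, Real.rpow_add_one hx0.ne']
          ring
    · intro x hx1
      have hx0 : 0 < ‖x‖ := one_pos.trans hx1
      simp only [D]
      rw [indicator_of_notMem (by simpa using hx1), norm_mul, Complex.norm_real,
        Real.norm_of_nonneg (by positivity), sub_zero]
      calc ‖x‖ ^ (-(n : ℝ)) * ‖h x‖ = ‖x‖ ^ (-((n : ℝ) + 1)) * (‖x‖ * ‖h x‖) := by
            rw [show -(n : ℝ) = -((n : ℝ) + 1) + 1 by ring, Real.rpow_add_one hx0.ne']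
            ring_nf
        _ ≤ ‖x‖ ^ (-((n : ℝ) + 1)) * C := by gcongr; exact h2 x
        _ = _ := mul_comm _ _
  refine ⟨∫ x, ‖D x‖, fun r hr hr1 => ?_⟩
  let A : Space n → ℂ := fun x => (((Ioc r 1).indicator (fun t : ℝ => t ^ (-(n : ℝ))) ‖x‖ : ℝ) : ℂ)
  let E : Space n → ℂ := ({x : Space n | r < ‖x‖}).indicator D
  have hS : MeasurableSet {x : Space n | r < ‖x‖} := measurableSet_lt measurable_const (by fun_prop)
  have hE : Integrable E := hD.indicator hS
  have hA : Integrable A := by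
    -- A non-integrable function has Bochner integral zero, so the nonzero value just computed
    -- implies integrability.
    refine (Integrable.of_integral_ne_zero
      (f := fun x : Space n => (Ioc r 1).indicator (fun t : ℝ => t ^ (-(n : ℝ))) ‖x‖) ?_).ofReal
    rw [integral_annulus hr hr1]
    have : 0 < (volume : Measure (Space n)).real (ball 0 1) :=
      
      ENNReal.toReal_pos (measure_ball_pos _ _ one_pos).ne' measure_ball_lt_top.ne
    have hn : (0 : ℝ) < n := by exact_mod_cast NeZero.pos n
    have := Real.log_pos ((one_lt_inv₀ hr).2 hr1)
    rw [sphereArea]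
    positivity
  have hAE : ∀ y, r ^ n • (A (r • y) + E (r • y)) = (closedBall (0 : Space n) 1)ᶜ.indicator
        (fun y => ((‖y‖ ^ (-(n : ℝ)) : ℝ) : ℂ) * h (r • y)) y := by
    intro y
    have hny : ‖r • y‖ = r * ‖y‖ := by rw [norm_smul, Real.norm_of_nonneg hr.le]
    by_cases hy : 1 < ‖y‖
    · have hy' : r • y ∈ {x : Space n | r < ‖x‖} := by
        rw [mem_ofPred_eq, hny]
        exact lt_mul_of_one_lt_right hr hy
      rw [indicator_of_mem (by simpa using hy)]
      simp only [E, indicator_of_mem hy', A, D]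
      have e : r ^ n * ‖r • y‖ ^ (-(n : ℝ)) = ‖y‖ ^ (-(n : ℝ)) := by
        rw [hny, Real.mul_rpow hr.le (norm_nonneg _), Real.rpow_neg hr.le, Real.rpow_natCast,
          ← mul_assoc, mul_inv_cancel₀ (by positivity), one_mul]
      rw [← e]
      by_cases h3 : ‖r • y‖ ≤ 1
      · rw [indicator_of_mem (show ‖r • y‖ ∈ Ioc r 1 from ⟨hy', h3⟩), indicator_of_mem (by simpa using h3),
          Complex.real_smul]
        push_cast
        simp only [Pi.one_apply]
        ring
      · rw [indicator_of_notMem (fun h : ‖r • y‖ ∈ Ioc r 1 => h3 h.2), indicator_of_notMem (by simpa using h3),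
          Complex.real_smul]
        push_cast
        ring
    · have hy' : ¬ r < ‖r • y‖ := by
        rw [hny, not_lt]
        exact mul_le_of_le_one_right hr.le (not_lt.1 hy)
      rw [indicator_of_notMem (by simpa using hy)]
      simp only [E, A]
      rw [indicator_of_notMem (fun h : ‖r • y‖ ∈ Ioc r 1 => hy' h.1),
        indicator_of_notMem (s := {x : Space n | r < ‖x‖}) hy']
      simp
  constructor
  · exact (((hA.add hE).comp_smul hr.ne').smul (r ^ n)).congr (.of_forall hAE)
  · rw [← integral_congr_ae (.of_forall hAE), integral_smul,
      integral_comp_smul_eq (fun x => A x + E x) hr, integral_add hA hE]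
    have : ∫ x, A x = ((sphereArea n * Real.log r⁻¹ : ℝ) : ℂ) := by
      rw [← integral_annulus hr hr1]
      exact integral_ofReal
    rw [this, add_sub_cancel_left]
    refine norm_integral_le_of_norm_le hD.norm (.of_forall fun x => ?_)
    exact norm_indicator_le_norm_self _ _

/-- A function with the borderline tail `c |y|^{-n}`, tested against `ψ(r ·)`, grows like
`c log (1 / r)`. -/
theorem tendsto_div_log {g ψ : Space n → ℂ} {c : ℂ} (hgm : AEStronglyMeasurable g)
    (hloc : ∀ R, IntegrableOn g (closedBall 0 R)) (htail : HasPowerTail g n c)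
    (hψ : Continuous ψ) {C : ℝ} (h0 : ∀ x, ‖ψ x‖ ≤ C)
    (h1 : ∀ x, ‖ψ x - 1‖ ≤ C * ‖x‖) (h2 : ∀ x, ‖x‖ * ‖ψ x‖ ≤ C) :
    Tendsto (fun r : ℝ => (∫ y, g y * ψ (r • y)) / ((Real.log r⁻¹ : ℝ) : ℂ)) (𝓝[>] 0)
      (𝓝 (sphereArea n * c)) := by
  obtain ⟨M, hM⟩ := integral_outside_unit_ball hψ.aestronglyMeasurable h1 h2
  -- The remainder of the tail is controlled only in modulus, so the logarithmic bound is also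
  -- needed for `|ψ|`.
  obtain ⟨M', hM'⟩ := integral_outside_unit_ball (h := fun x => ((‖ψ x‖ : ℝ) : ℂ)) (C := C)
    (Complex.continuous_ofReal.comp hψ.norm).aestronglyMeasurable
    (fun x => by
      rw [← Complex.ofReal_one, ← Complex.ofReal_sub, Complex.norm_real]
      have := abs_norm_sub_norm_le (ψ x) 1
      rw [norm_one] at this
      exact this.trans (h1 x))
    (fun x => by simpa using h2 x)
  have hC : 0 ≤ C := (norm_nonneg _).trans (h0 0)
  have hK : 0 ≤ sphereArea n := by unfold sphereArea; positivity
  let P : Space n → ℂ := (closedBall (0 : Space n) 1)ᶜ.indicator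
    fun y => ((‖y‖ ^ (-(n : ℝ)) : ℝ) : ℂ)
  have hPm : AEStronglyMeasurable P :=
    ((Complex.measurable_ofReal.comp (measurable_norm_rpow _)).indicator
      measurableSet_closedBall.compl).aestronglyMeasurable
  have hPloc : ∀ R, IntegrableOn P (closedBall 0 R) := fun R => by
    refine (integrableOn_const (C := (1 : ℝ)) (measure_closedBall_lt_top).ne).mono'
      hPm.restrict (.of_forall fun y => ?_)
    by_cases hy : y ∈ (closedBall (0 : Space n) 1)ᶜ
    · simp only [P, indicator_of_mem hy]
      rw [Complex.norm_real, Real.norm_of_nonneg (by positivity)]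
      exact Real.rpow_le_one_of_one_le_of_nonpos (by simpa using (show 1 < ‖y‖ by simpa using hy).le)
        (by simp)
    · simp only [P, indicator_of_notMem hy]
      simp
  let e : Space n → ℂ := fun y => g y - c * P y
  have hem : AEStronglyMeasurable e := hgm.sub (hPm.const_mul c)
  have heloc : ∀ R, IntegrableOn e (closedBall 0 R) := fun R =>
    (hloc R).sub ((hPloc R).const_mul c)
  -- Beyond a radius `R(δ)` the remainder `e = g - c P` is at most `δ |y|^{-n}` and contributes a
  -- `δ`-fraction of the logarithm; everything else is bounded in `r`.
  have hbound : ∀ δ : ℝ, 0 < δ → ∃ A : ℝ, ∀ r : ℝ, 0 < r → r < 1 →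
      ‖(∫ y, g y * ψ (r • y)) - sphereArea n * c * ((Real.log r⁻¹ : ℝ) : ℂ)‖
        ≤ A + δ * sphereArea n * Real.log r⁻¹ := by
    intro δ hδ
    obtain ⟨R, hR1, hR⟩ := htail.eventually_norm_sub_le hδ
    refine ⟨(∫ y in closedBall (0 : Space n) R, ‖e y‖ * C) + δ * M' + ‖c‖ * M, fun r hr hr1 => ?_⟩
    have hMr := hM r hr hr1
    have hMr' := hM' r hr hr1
    let Q : Space n → ℝ := (closedBall (0 : Space n) 1)ᶜ.indicator
      fun y => ‖y‖ ^ (-(n : ℝ)) * ‖ψ (r • y)‖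
    have hQ : ∀ y, (Q y : ℂ) = (closedBall (0 : Space n) 1)ᶜ.indicator
        (fun y => ((‖y‖ ^ (-(n : ℝ)) : ℝ) : ℂ) * ((‖ψ (r • y)‖ : ℝ) : ℂ)) y := by
      intro y
      by_cases hy : y ∈ (closedBall (0 : Space n) 1)ᶜ
      · simp only [Q, indicator_of_mem hy, Complex.ofReal_mul]
      · simp only [Q, indicator_of_notMem hy, Complex.ofReal_zero]
    have hQint : Integrable Q := by
      have := (hMr'.1.congr (.of_forall fun y => (hQ y).symm)).re
      simpa using this
    have hQval : ∫ y, Q y ≤ sphereArea n * Real.log r⁻¹ + M' := by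
      have h3 := hMr'.2
      rw [← integral_congr_ae (.of_forall hQ), integral_complex_ofReal, ← Complex.ofReal_sub,
        Complex.norm_real] at h3
      linarith [(abs_le.1 h3).2]
    let N : Space n → ℝ := fun y =>
      (closedBall (0 : Space n) R).indicator (fun y => ‖e y‖ * C) y + δ * Q y
    have hNint : Integrable N := by
      refine Integrable.add ?_ (hQint.const_mul δ)
      rw [integrable_indicator_iff measurableSet_closedBall]
      exact (heloc R).norm.mul_const C
    have hQ0 : ∀ y, 0 ≤ Q y := fun y => indicator_nonneg (fun y _ => by positivity) y
    have heN : ∀ y, ‖e y * ψ (r • y)‖ ≤ N y := by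
      intro y
      rw [norm_mul]
      by_cases hy : R < ‖y‖
      · have hy1 : y ∈ (closedBall (0 : Space n) 1)ᶜ := by simpa using hR1.trans_lt hy
        have h3 := hR y hy
        simp only [N, e, P, Q, indicator_of_mem hy1]
        rw [indicator_of_notMem (by simpa using hy), zero_add, ← mul_assoc]
        gcongr
      · simp only [N]
        rw [indicator_of_mem (by simpa using hy)]
        have := mul_le_mul_of_nonneg_left (h0 (r • y)) (norm_nonneg (e y))
        have := mul_nonneg hδ.le (hQ0 y)
        linarith
    have heint : Integrable fun y => e y * ψ (r • y) :=
      hNint.mono' (hem.mul (by fun_prop : Continuous fun y => ψ (r • y)).aestronglyMeasurable)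
        (.of_forall heN)
    have hsplit : ∫ y, g y * ψ (r • y) = (∫ y, e y * ψ (r • y)) +
        c * ∫ y, (closedBall (0 : Space n) 1)ᶜ.indicator
          (fun y => ((‖y‖ ^ (-(n : ℝ)) : ℝ) : ℂ) * ψ (r • y)) y := by
      rw [← integral_const_mul, ← integral_add heint (hMr.1.const_mul c)]
      congr 1 with y
      by_cases hy : y ∈ (closedBall (0 : Space n) 1)ᶜ
      · simp only [e, P, indicator_of_mem hy]
        ring
      · simp only [e, P, indicator_of_notMem hy]
        ring
    have he : ‖∫ y, e y * ψ (r • y)‖ ≤ (∫ y in closedBall (0 : Space n) R, ‖e y‖ * C) +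
        δ * (sphereArea n * Real.log r⁻¹ + M') := by
      refine (norm_integral_le_of_norm_le hNint (.of_forall heN)).trans ?_
      simp only [N]
      rw [integral_add ((integrable_indicator_iff measurableSet_closedBall).2
        ((heloc R).norm.mul_const C)) (hQint.const_mul δ),
        integral_indicator measurableSet_closedBall, integral_const_mul]
      gcongr
    rw [hsplit]
    rw [show ∀ a b k l : ℂ, a + c * b - k * c * l = a + c * (b - k * l) from
      fun _ _ _ _ => by ring]
    have h5 := mul_le_mul_of_nonneg_left hMr.2 (norm_nonneg c)
    rw [← norm_mul, Complex.ofReal_mul] at h5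
    refine (norm_add_le _ _).trans ((add_le_add he h5).trans_eq ?_)
    ring
  have hlog : Tendsto (fun r : ℝ => Real.log r⁻¹) (𝓝[>] 0) atTop :=
    Real.tendsto_log_atTop.comp tendsto_inv_nhdsGT_zero
  rw [Metric.tendsto_nhds]
  intro η hη
  -- This `δ` makes the logarithmic error at most `η / 2` after division; the `+ 1` keeps the
  -- denominator positive knowing only `0 ≤ sphereArea n`.
  obtain ⟨A, hA⟩ := hbound (η / (2 * (sphereArea n + 1))) (by positivity)
  have hr1 : ∀ᶠ r : ℝ in 𝓝[>] 0, 0 < r ∧ r < 1 := Ioo_mem_nhdsGT one_pos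
  filter_upwards [hr1, hlog.eventually_gt_atTop (2 * A / η)] with r hr hA2
  have hl : 0 < Real.log r⁻¹ := Real.log_pos ((one_lt_inv₀ hr.1).2 hr.2)
  have hlC : ((Real.log r⁻¹ : ℝ) : ℂ) ≠ 0 := by exact_mod_cast hl.ne'
  have h3 := hA r hr.1 hr.2
  have h4 : η / (2 * (sphereArea n + 1)) * sphereArea n * Real.log r⁻¹ ≤
      η / 2 * Real.log r⁻¹ := by
    gcongr
    rw [div_mul_eq_mul_div, div_le_div_iff₀ (by positivity) two_pos]
    nlinarith
  rw [div_lt_iff₀ hη] at hA2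
  rw [dist_eq_norm, div_sub' hlC, norm_div, Complex.norm_real, Real.norm_of_nonneg hl.le,
    div_lt_iff₀ hl, mul_comm ((Real.log r⁻¹ : ℝ) : ℂ)]
  linarith

end Logarithm

/-! ### Fourier transform of the Riesz kernel by Gaussian superposition -/

section Subordination

variable {n : ℕ}

/-- The power `|x|^{-2a}` as a superposition of Gaussians. -/
theorem Gamma_mul_integral_rpow [NeZero n] {a : ℝ} (ha : 0 < a) {f : Space n → ℂ}
    (hf : AEStronglyMeasurable f)
    (hint : Integrable fun x => ((‖x‖ ^ (-(2 * a)) : ℝ) : ℂ) * f x) :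
    (Real.Gamma a : ℂ) * ∫ x, ((‖x‖ ^ (-(2 * a)) : ℝ) : ℂ) * f x =
      ∫ b in Ioi (0 : ℝ), ((b ^ (a - 1) : ℝ) : ℂ) *
        ∫ x, ((Real.exp (-(b * ‖x‖ ^ 2)) : ℝ) : ℂ) * f x := by
  have hG : 0 < Real.Gamma a := Real.Gamma_pos_of_pos ha
  let k : Space n → ℝ → ℝ := fun x b => b ^ (a - 1) * Real.exp (-(‖x‖ ^ 2 * b))
  have hk : ∀ x : Space n, x ≠ 0 → ∫ b in Ioi (0 : ℝ), k x b = ‖x‖ ^ (-(2 * a)) * Real.Gamma a := by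
    intro x hx
    have hx0 : 0 < ‖x‖ := norm_pos_iff.2 hx
    rw [Real.integral_rpow_mul_exp_neg_mul_Ioi ha (by positivity : 0 < ‖x‖ ^ 2), one_div,
      Real.inv_rpow (by positivity), Real.rpow_neg hx0.le, ← Real.rpow_natCast, ← Real.rpow_mul hx0.le]
    norm_num
  have hki : ∀ x : Space n, x ≠ 0 → IntegrableOn (k x) (Ioi 0) := by
    intro x hx
    have hx0 : 0 < ‖x‖ := norm_pos_iff.2 hx
    refine Integrable.of_integral_ne_zero ?_
    rw [hk x hx]
    positivity
  have hk0 : ∀ x : Space n, ∀ b ∈ Ioi (0 : ℝ), 0 ≤ k x b := fun x b hb => by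
    have : (0 : ℝ) < b := hb
    positivity
  have hkm : Measurable (Function.uncurry k) := by
    unfold k Function.uncurry
    fun_prop
  let F : Space n → ℝ → ℂ := fun x b => (k x b : ℂ) * f x
  -- Fubini applies because the kernel is nonnegative: integrating the norm in `b` gives back `Γ(a)
  -- |x|^{-2a} |f x|`.
  have hF : Integrable (Function.uncurry F) (volume.prod (volume.restrict (Ioi 0))) := by
    have hFm : AEStronglyMeasurable (Function.uncurry F)
        (volume.prod (volume.restrict (Ioi 0))) :=
      (Complex.measurable_ofReal.comp hkm).aestronglyMeasurable.mul hf.comp_fst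
    rw [integrable_prod_iff hFm]
    constructor
    · filter_upwards [ae_ne_zero] with x hx
      exact Integrable.mul_const (Integrable.ofReal (𝕜 := ℂ) (hki x hx)) (f x)
    · refine (hint.norm.const_mul (Real.Gamma a)).congr ?_
      filter_upwards [ae_ne_zero] with x hx
      simp only [Function.uncurry_apply_pair, F, norm_mul, Complex.norm_real]
      rw [integral_mul_const, setIntegral_congr_fun measurableSet_Ioi
        fun b hb => Real.norm_of_nonneg (hk0 x b hb), hk x hx,
        Real.norm_of_nonneg (by positivity)]
      ring
  calc (Real.Gamma a : ℂ) * ∫ x, ((‖x‖ ^ (-(2 * a)) : ℝ) : ℂ) * f x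
      = ∫ x, ∫ b in Ioi (0 : ℝ), F x b := by
        rw [← integral_const_mul]
        refine integral_congr_ae ?_
        filter_upwards [ae_ne_zero] with x hx
        simp only [F]
        rw [integral_mul_const, integral_complex_ofReal, hk x hx]
        push_cast
        ring
    _ = ∫ b in Ioi (0 : ℝ), ∫ x, F x b := integral_integral_swap hF
    _ = _ := by
        congr 1 with b
        rw [← integral_const_mul]
        congr 1 with x
        simp only [F, k]
        push_cast
        ring_nf

/-- The multiplication formula moves the transform from `φ` onto the Gaussian, where it is explicit.
-/
theorem integral_gaussian_mul_fourier (φ : 𝓢(Space n, ℂ)) {b : ℝ} (hb : 0 < b) :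
    ∫ x, ((Real.exp (-(b * ‖x‖ ^ 2)) : ℝ) : ℂ) * (𝓕 φ) x =
      (((Real.pi / b) ^ ((n : ℝ) / 2) : ℝ) : ℂ) *
        ∫ p, ((Real.exp (-(Real.pi ^ 2 / b * ‖p‖ ^ 2)) : ℝ) : ℂ) * φ p := by
  have hg : Integrable fun x : Space n => Complex.exp (-(b : ℂ) * ‖x‖ ^ 2) := by
    simpa using GaussianFourier.integrable_cexp_neg_mul_sq_norm_add (V := Space n) (b := b)
      (by simpa using hb) 0 0
  have h1 : ∫ x, (𝓕 φ) x * Complex.exp (-(b : ℂ) * ‖x‖ ^ 2) =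
      ∫ p, φ p * 𝓕 (fun x : Space n => Complex.exp (-(b : ℂ) * ‖x‖ ^ 2)) p := by
    simpa using! VectorFourier.integral_fourierIntegral_smul_eq_flip (L := innerₗ (Space n))
      Real.continuous_fourierChar continuous_inner φ.integrable hg
  rw [← integral_const_mul]
  calc _ = ∫ x, (𝓕 φ) x * Complex.exp (-(b : ℂ) * ‖x‖ ^ 2) := by
        congr 1 with x
        push_cast
        ring_nf
    _ = _ := h1
    _ = _ := by
        congr 1 with p
        rw [fourier_gaussian_innerProductSpace (by simpa using hb), finrank_euclideanSpace_fin,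
          Complex.ofReal_cpow (by positivity)]
        push_cast
        ring_nf

/-- The constant in the Fourier transform of `|x|^{-(n-ε)}`. -/
noncomputable def rieszConst (n : ℕ) (ε : ℝ) : ℝ :=
  Real.pi ^ ((n : ℝ) / 2 - ε) * Real.Gamma (ε / 2) / Real.Gamma ((n - ε) / 2)

theorem rieszConst_pos {ε : ℝ} (h0 : 0 < ε) (h1 : ε < n) : 0 < rieszConst n ε := by
  have := Real.Gamma_pos_of_pos (half_pos h0)
  have := Real.Gamma_pos_of_pos (half_pos (sub_pos.2 h1))
  unfold rieszConst
  positivity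

theorem integrable_rpow_mul_schwartz [NeZero n] {s : ℝ} (h0 : 0 ≤ s) (hs : s < n) (φ : 𝓢(Space n, ℂ)) :
    Integrable fun x => ((‖x‖ ^ (-s) : ℝ) : ℂ) * φ x := by
  obtain ⟨C, hC, h1⟩ := exists_pow_mul_norm_le φ 0
  obtain ⟨D, hD, h2⟩ := exists_pow_mul_norm_le φ (n + 1)
  refine integrable_of_near_of_decay (a := s) (C := C)
    ((Complex.measurable_ofReal.comp (measurable_norm_rpow _)).aestronglyMeasurable.mul
      φ.continuous.aestronglyMeasurable) hs (fun x hx hx1 => ?_) ⟨D, fun x hx => ?_⟩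
  all_goals rw [norm_mul, Complex.norm_real, Real.norm_of_nonneg (by positivity)]
  · rw [mul_comm]
    gcongr
    simpa using h1 x
  · refine le_trans ?_ (h2 x)
    gcongr
    exact mul_le_of_le_one_left (norm_nonneg _)
      (Real.rpow_le_one_of_one_le_of_nonpos hx.le (by linarith))

/-- The Fourier transform of `|x|^{-(n-ε)}` is a multiple of `|p|^{-ε}`. -/
theorem integral_rpow_mul_fourier [NeZero n] {ε : ℝ} (h0 : 0 < ε) (h1 : ε < n) (φ : 𝓢(Space n, ℂ)) :
    ∫ x, ((‖x‖ ^ (-(n - ε)) : ℝ) : ℂ) * (𝓕 φ) x =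
      rieszConst n ε * ∫ p, ((‖p‖ ^ (-ε) : ℝ) : ℂ) * φ p := by
  have hs : 0 < (n - ε) / 2 := half_pos (sub_pos.2 h1)
  have e1 := Gamma_mul_integral_rpow hs (𝓕 φ).continuous.aestronglyMeasurable
    (by rw [mul_div_cancel₀ _ two_ne_zero]
        exact integrable_rpow_mul_schwartz (by linarith) (by linarith) _)
  have e2 := Gamma_mul_integral_rpow (half_pos h0) φ.continuous.aestronglyMeasurable
    (by rw [mul_div_cancel₀ _ two_ne_zero]
        exact integrable_rpow_mul_schwartz h0.le h1 _)
  rw [mul_div_cancel₀ _ two_ne_zero] at e1 e2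
  have hpi := Real.pi_pos
  have e3 : ∫ b in Ioi (0 : ℝ), ((b ^ ((n - ε) / 2 - 1) : ℝ) : ℂ) *
        ∫ x, ((Real.exp (-(b * ‖x‖ ^ 2)) : ℝ) : ℂ) * (𝓕 φ) x =
      ((Real.pi ^ ((n : ℝ) / 2 - ε) : ℝ) : ℂ) * ∫ u in Ioi (0 : ℝ), ((u ^ (ε / 2 - 1) : ℝ) : ℂ) *
        ∫ x, ((Real.exp (-(u * ‖x‖ ^ 2)) : ℝ) : ℂ) * φ x := by
    -- The substitution is `b = π² / u`, done as a dilation by `π²` followed by inversion. It turns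
    -- the dual Gaussian parameter `π² / b` into `u` and the exponent `(n - ε) / 2` into `ε / 2`.
    have h2 := integral_comp_mul_left_Ioi' (fun b : ℝ => ((b ^ ((n - ε) / 2 - 1) : ℝ) : ℂ) *
        ∫ x, ((Real.exp (-(b * ‖x‖ ^ 2)) : ℝ) : ℂ) * (𝓕 φ) x) 0 (pow_pos hpi 2)
    rw [mul_zero] at h2
    rw [← h2, ← integral_comp_rpow_Ioi _ (by norm_num : (-1 : ℝ) ≠ 0), ← integral_const_mul,
      ← integral_smul]
    refine setIntegral_congr_fun measurableSet_Ioi fun u hu => ?_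
    have hu : 0 < u := hu
    simp only [Real.rpow_neg_one]
    rw [integral_gaussian_mul_fourier φ (by positivity : 0 < Real.pi ^ 2 * u⁻¹),
      show Real.pi ^ 2 / (Real.pi ^ 2 * u⁻¹) = u by field_simp]
    simp only [Complex.real_smul, ← mul_assoc, ← Complex.ofReal_mul]
    congr 2
    rw [show Real.pi / (Real.pi ^ 2 * u⁻¹) = Real.pi⁻¹ * u by field_simp,
      Real.mul_rpow (by positivity) (by positivity), Real.mul_rpow (by positivity) (by positivity),
      ← Real.rpow_natCast, ← Real.rpow_mul hpi.le, ← Real.rpow_neg_one u, ← Real.rpow_neg_one Real.pi,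
      ← Real.rpow_mul hu.le, ← Real.rpow_mul hpi.le, abs_neg, abs_one]
    calc _ = (Real.pi ^ ((2 : ℕ) : ℝ) * Real.pi ^ (((2 : ℕ) : ℝ) * ((n - ε) / 2 - 1)) *
          Real.pi ^ (-1 * ((n : ℝ) / 2))) * (u ^ (-1 - 1 : ℝ) * u ^ (-1 * ((n - ε) / 2 - 1)) *
          u ^ ((n : ℝ) / 2)) := by ring
      _ = _ := by
        simp only [← Real.rpow_add hpi, ← Real.rpow_add hu]
        congr 2 <;> push_cast <;> ring
  rw [e3, ← e2] at e1
  have hG : (Real.Gamma ((n - ε) / 2) : ℂ) ≠ 0 := by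
    exact_mod_cast (Real.Gamma_pos_of_pos hs).ne'
  rw [← mul_right_inj' hG, e1, rieszConst]
  push_cast
  field_simp

end Subordination

/-! ### The logarithm as the limit of Riesz kernels -/

section LogKernel

/-- A mean value bound: between `0` and `x` the derivative is at most `1 + exp x`. It controls
`(|p|^{-ε} - 1) / ε` uniformly in small `ε`. -/
theorem abs_exp_sub_one_le_mul (x : ℝ) : |Real.exp x - 1| ≤ |x| * (1 + Real.exp x) := by
  have h1 := Real.add_one_le_exp x
  have h2 := Real.add_one_le_exp (-x)
  have h3 : Real.exp x * Real.exp (-x) = 1 := by rw [← Real.exp_add]; simp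
  have h4 := Real.exp_pos x
  rcases le_total 0 x with hx | hx
  · rw [abs_of_nonneg (by linarith), abs_of_nonneg hx]
    nlinarith
  · rw [abs_of_nonpos (by linarith [Real.exp_le_one_iff.2 hx]), abs_of_nonpos hx]
    nlinarith

variable {n : ℕ}

/-- The exponent `1/4` leaves room for a further factor `|x|^{-1/2}`: the total `3/4` stays below `1
≤ n`. -/
theorem abs_log_norm_le_near {x : Space n} (hx : x ≠ 0) (hx1 : ‖x‖ ≤ 1) :
    |Real.log ‖x‖| ≤ 4 * ‖x‖ ^ (-(1 / 4 : ℝ)) := by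
  have hx0 : 0 < ‖x‖ := norm_pos_iff.2 hx
  rw [abs_of_nonpos (Real.log_nonpos hx0.le hx1), ← Real.log_inv]
  refine (Real.log_le_rpow_div (inv_nonneg.2 hx0.le) (by norm_num : (0 : ℝ) < 1 / 4)).trans_eq ?_
  rw [Real.inv_rpow hx0.le, Real.rpow_neg hx0.le]
  ring

theorem abs_log_norm_le_far {x : Space n} (hx1 : 1 < ‖x‖) : |Real.log ‖x‖| ≤ ‖x‖ := by
  rw [abs_of_nonneg (Real.log_nonneg hx1.le)]
  exact Real.log_le_self (by positivity)

theorem exists_norm_sub_le_mul_norm (ψ : 𝓢(Space n, ℂ)) :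
    ∃ C, 0 < C ∧ ∀ x, ‖ψ x - ψ 0‖ ≤ C * ‖x‖ := by
  obtain ⟨C, hC, h⟩ := ψ.decay 0 1
  refine ⟨C, hC, fun x => ?_⟩
  have := Convex.norm_image_sub_le_of_norm_fderiv_le (𝕜 := ℝ) (f := ψ) (s := univ) (C := C)
    (fun y _ => ψ.differentiableAt) (fun y _ => by
      have := h y
      rwa [pow_zero, one_mul, ← norm_iteratedFDeriv_fderiv, norm_iteratedFDeriv_zero] at this)
    convex_univ (mem_univ 0) (mem_univ x)
  simpa using this

variable [NeZero n]

theorem exists_isRegular_of_near_of_far {g : Space n → ℂ} (hg : AEStronglyMeasurable g) {a C : ℝ}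
    (ha : a < n) (h1 : ∀ x, x ≠ 0 → ‖x‖ ≤ 1 → ‖g x‖ ≤ C * ‖x‖ ^ (-a))
    (h2 : ∀ x, 1 < ‖x‖ → ‖g x‖ ≤ C * ‖x‖) : ∃ T : 𝓢'(Space n, ℂ), IsRegular T g := by
  -- The decay criterion needs `n + 1` powers, and one more absorbs the linear growth of `g`.
  refine exists_isRegular hg (n + 2) (integrable_of_near_of_decay (a := a) (C := C) ?_ ha
    (fun x hx hx1 => ?_) ⟨C, fun x hx => ?_⟩)
  · exact (by fun_prop : Measurable fun y : Space n =>
      ((1 + ‖y‖) ^ (n + 2))⁻¹).aestronglyMeasurable.mul hg.norm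
  all_goals rw [norm_mul, norm_inv, norm_norm, Real.norm_of_nonneg (by positivity)]
  · refine (mul_le_of_le_one_left (norm_nonneg _) ?_).trans (h1 x hx hx1)
    exact inv_le_one_of_one_le₀ (one_le_pow₀ (by linarith [norm_nonneg x]))
  · have hx0 : 0 < ‖x‖ := one_pos.trans hx
    have hC : 0 ≤ C := nonneg_of_mul_nonneg_left ((norm_nonneg _).trans (h2 x hx)) hx0
    calc ‖x‖ ^ (n + 1) * (((1 + ‖x‖) ^ (n + 2))⁻¹ * ‖g x‖)
        ≤ ‖x‖ ^ (n + 1) * ((‖x‖ ^ (n + 2))⁻¹ * (C * ‖x‖)) := by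
          gcongr
          · linarith
          · exact h2 x hx
      _ = C := by
        field_simp
        ring

theorem one_le_natCast : (1 : ℝ) ≤ n := by exact_mod_cast NeZero.one_le

theorem exists_isRegular_rpow {ε : ℝ} (h0 : 0 < ε) (h1 : ε < n) (C : ℂ) :
    ∃ U : 𝓢'(Space n, ℂ), IsRegular U fun p => C * ((‖p‖ ^ (-ε) : ℝ) : ℂ) := by
  refine exists_isRegular_of_near_of_far (a := ε) (C := ‖C‖)
    ((Complex.measurable_ofReal.comp (measurable_norm_rpow _)).aestronglyMeasurable.const_mul _)
    h1 ?_ ?_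
  all_goals intro x
  all_goals rw [norm_mul, Complex.norm_real, Real.norm_of_nonneg (by positivity)]
  · exact fun _ _ => le_rfl
  · intro hx
    gcongr
    exact (Real.rpow_le_one_of_one_le_of_nonpos hx.le (by linarith)).trans hx.le

theorem exists_isRegular_log (C : ℂ) :
    ∃ L : 𝓢'(Space n, ℂ), IsRegular L fun p => C * ((Real.log ‖p‖ : ℝ) : ℂ) := by
  have hn := one_le_natCast (n := n)
  refine exists_isRegular_of_near_of_far (a := 1 / 4) (C := ‖C‖ * 4)
    (Measurable.aestronglyMeasurable (by fun_prop)) (by linarith) ?_ ?_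
  all_goals intro x
  all_goals rw [norm_mul, Complex.norm_real, Real.norm_eq_abs, mul_assoc]
  · intro hx hx1
    gcongr
    exact abs_log_norm_le_near hx hx1
  · intro hx
    gcongr
    exact (abs_log_norm_le_far hx).trans (by linarith)

/-- A majorant of the difference quotients `(|p|^{-ε} - 1) / ε`. -/
theorem exists_isRegular_log_majorant : ∃ L : 𝓢'(Space n, ℂ),
    IsRegular L fun p => (((2 + ‖p‖ ^ (-(1 / 2 : ℝ))) * |Real.log ‖p‖| : ℝ) : ℂ) := by
  have hn := one_le_natCast (n := n)
  refine exists_isRegular_of_near_of_far (a := 3 / 4) (C := 12)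
    (Complex.measurable_ofReal.comp
      (((measurable_norm_rpow _).const_add 2).mul (by fun_prop))).aestronglyMeasurable
    (by linarith) ?_ ?_
  all_goals intro x
  all_goals rw [Complex.norm_real, Real.norm_of_nonneg (by positivity)]
  · intro hx hx1
    have hx0 : 0 < ‖x‖ := norm_pos_iff.2 hx
    have h1 : 1 ≤ ‖x‖ ^ (-(1 / 2 : ℝ)) :=
      Real.one_le_rpow_of_pos_of_le_one_of_nonpos hx0 hx1 (by norm_num)
    calc _ ≤ (3 * ‖x‖ ^ (-(1 / 2 : ℝ))) * (4 * ‖x‖ ^ (-(1 / 4 : ℝ))) := by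
          gcongr
          · linarith
          · exact abs_log_norm_le_near hx hx1
      _ = 12 * (‖x‖ ^ (-(1 / 2 : ℝ)) * ‖x‖ ^ (-(1 / 4 : ℝ))) := by ring
      _ = _ := by rw [← Real.rpow_add hx0]; norm_num
  · intro hx
    have h1 : ‖x‖ ^ (-(1 / 2 : ℝ)) ≤ 1 :=
      Real.rpow_le_one_of_one_le_of_nonpos hx.le (by norm_num)
    calc _ ≤ (2 + 1 : ℝ) * ‖x‖ := by
          gcongr
          exact abs_log_norm_le_far hx
      _ ≤ _ := by gcongr; norm_num

/-- The zero at the origin supplies the missing power of `|x|`. The factor `1 + |x|` lets the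
function dominate `|x|^{-(n-ε)} ψ` for all `0 ≤ ε ≤ 1` at once. -/
theorem integrable_rpow_neg_natCast_mul_schwartz {ψ : 𝓢(Space n, ℂ)} (h0 : ψ 0 = 0) :
    Integrable fun x => ((‖x‖ ^ (-(n : ℝ)) * (1 + ‖x‖) : ℝ) : ℂ) * ψ x := by
  obtain ⟨C, hC, h1⟩ := exists_norm_sub_le_mul_norm ψ
  obtain ⟨D, hD, h2⟩ := exists_pow_mul_norm_le ψ (n + 2)
  simp only [h0, sub_zero] at h1
  refine integrable_of_near_of_decay (a := n - 1) (C := 2 * C)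
    ((Complex.measurable_ofReal.comp ((measurable_norm_rpow _).mul
      (by fun_prop))).aestronglyMeasurable.mul
      ψ.continuous.aestronglyMeasurable) (by linarith) (fun x hx hx1 => ?_) ⟨2 * D, fun x hx => ?_⟩
  all_goals rw [norm_mul, Complex.norm_real, Real.norm_of_nonneg (by positivity)]
  · have hx0 : 0 < ‖x‖ := norm_pos_iff.2 hx
    calc _ ≤ ‖x‖ ^ (-(n : ℝ)) * (1 + 1) * (C * ‖x‖) := by
          gcongr
          exact h1 x
      _ = 2 * C * ‖x‖ ^ (-((n : ℝ) - 1)) := by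
          rw [show -((n : ℝ) - 1) = -n + 1 by ring, Real.rpow_add_one hx0.ne']
          ring
  · have h3 : ‖x‖ ^ (-(n : ℝ)) ≤ 1 :=
      Real.rpow_le_one_of_one_le_of_nonpos hx.le (by simp)
    calc _ ≤ ‖x‖ ^ (n + 1) * (1 * (‖x‖ + ‖x‖) * ‖ψ x‖) := by gcongr
      _ = 2 * (‖x‖ ^ (n + 2) * ‖ψ x‖) := by ring
      _ ≤ _ := by gcongr; exact h2 x

theorem sphereArea_eq : sphereArea n = 2 * Real.pi ^ ((n : ℝ) / 2) / Real.Gamma (n / 2) := by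
  have hn : (0 : ℝ) < n := by exact_mod_cast NeZero.pos n
  have hG := Real.Gamma_pos_of_pos (half_pos hn)
  have hpi := Real.pi_pos
  rw [sphereArea, Measure.real, EuclideanSpace.volume_ball, Fintype.card_fin,
    Real.Gamma_add_one (half_pos hn).ne', ENNReal.ofReal_one, one_pow, one_mul,
    ENNReal.toReal_ofReal (by positivity), Real.sqrt_eq_rpow, ← Real.rpow_natCast,
    ← Real.rpow_mul hpi.le, one_div_mul_eq_div]
  field_simp

theorem sphereArea_pos : 0 < sphereArea n := by
  have hn : (0 : ℝ) < n := by exact_mod_cast NeZero.pos n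
  have hG := Real.Gamma_pos_of_pos (half_pos hn)
  rw [sphereArea_eq]
  have := Real.pi_pos
  positivity

/-- The pole of `Γ` at zero gives the limit: `ε Γ(ε/2) = 2 Γ(ε/2 + 1)`, and the other factors are
continuous. -/
theorem tendsto_mul_rieszConst :
    Tendsto (fun ε : ℝ => ε * rieszConst n ε) (𝓝[>] 0) (𝓝 (sphereArea n)) := by
  have hn : (0 : ℝ) < n := by exact_mod_cast NeZero.pos n
  have hG := Real.Gamma_pos_of_pos (half_pos hn)
  have hc : ContinuousAt (fun ε : ℝ => 2 * Real.pi ^ ((n : ℝ) / 2 - ε) * Real.Gamma (ε / 2 + 1) /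
      Real.Gamma ((n - ε) / 2)) 0 := by
    have hd : ∀ s : ℝ, 0 < s → ContinuousAt Real.Gamma s := fun s hs =>
      (Real.differentiableAt_Gamma fun m => by
        have : (0 : ℝ) ≤ m := m.cast_nonneg
        linarith).continuousAt
    refine ContinuousAt.div (ContinuousAt.mul ?_ ?_) ?_ (by simpa using hG.ne')
    · exact continuousAt_const.mul (continuousAt_const.rpow (by fun_prop)
        (.inl Real.pi_pos.ne'))
    · exact ContinuousAt.comp (f := fun ε : ℝ => ε / 2 + 1) (hd _ (by norm_num)) (by fun_prop)
    · exact ContinuousAt.comp (f := fun ε : ℝ => (n - ε) / 2) (hd _ (by simpa using hn))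
        (by fun_prop)
  have h0 := hc.tendsto.mono_left (nhdsWithin_le_nhds (s := Ioi (0 : ℝ)))
  simp only [sub_zero, zero_div, zero_add, Real.Gamma_one, mul_one] at h0
  rw [← sphereArea_eq] at h0
  refine h0.congr' ?_
  filter_upwards [self_mem_nhdsWithin] with ε hε
  have hε : (0 : ℝ) < ε := hε
  rw [rieszConst, Real.Gamma_add_one (half_pos hε).ne']
  ring

/-- The Fourier transform of `|x|^{-n}` is a multiple of `-log |p|` up to a constant. -/
theorem integral_rpow_neg_mul_fourier {ψ : 𝓢(Space n, ℂ)} (hψ : ∫ p, ψ p = 0) :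
    ∫ x, ((‖x‖ ^ (-(n : ℝ)) : ℝ) : ℂ) * (𝓕 ψ) x =
      -(sphereArea n * ∫ p, ((Real.log ‖p‖ : ℝ) : ℂ) * ψ p) := by
  have hn := one_le_natCast (n := n)
  have hψ0 : (𝓕 ψ) 0 = 0 := by
    rw [SchwartzMap.fourier_coe, Real.fourier_eq]
    simpa using hψ
  have hε : ∀ᶠ ε : ℝ in 𝓝[>] 0, 0 < ε ∧ ε < 1 / 2 := Ioo_mem_nhdsGT (by norm_num)
  have hleft : Tendsto (fun ε : ℝ => ∫ x, ((‖x‖ ^ (-(n - ε)) : ℝ) : ℂ) * (𝓕 ψ) x) (𝓝[>] 0)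
      (𝓝 (∫ x, ((‖x‖ ^ (-(n : ℝ)) : ℝ) : ℂ) * (𝓕 ψ) x)) := by
    refine tendsto_integral_filter_of_dominated_convergence _
      (.of_forall fun ε => (Complex.measurable_ofReal.comp
        (measurable_norm_rpow _)).aestronglyMeasurable.mul
        (𝓕 ψ).continuous.aestronglyMeasurable) ?_
      (integrable_rpow_neg_natCast_mul_schwartz hψ0).norm ?_
    · filter_upwards [hε] with ε hε
      filter_upwards [ae_ne_zero] with x hx
      have hx0 : 0 < ‖x‖ := norm_pos_iff.2 hx
      rw [norm_mul, norm_mul, Complex.norm_real, Complex.norm_real,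
        Real.norm_of_nonneg (by positivity), Real.norm_of_nonneg (by positivity), neg_sub,
        sub_eq_neg_add, Real.rpow_add hx0]
      gcongr
      rcases le_total ‖x‖ 1 with h | h
      · linarith [Real.rpow_le_one hx0.le h hε.1.le]
      · have := Real.rpow_le_rpow_of_exponent_le h (show ε ≤ 1 by linarith)
        rw [Real.rpow_one] at this
        linarith
    · filter_upwards [ae_ne_zero] with x hx
      have hx0 : 0 < ‖x‖ := norm_pos_iff.2 hx
      have : ContinuousAt (fun ε : ℝ => ((‖x‖ ^ (-(n - ε)) : ℝ) : ℂ) * (𝓕 ψ) x) 0 := by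
        refine ContinuousAt.mul (Complex.continuous_ofReal.continuousAt.comp ?_) continuousAt_const
        exact continuousAt_const.rpow (by fun_prop) (.inl hx0.ne')
      simpa using this.tendsto.mono_left (nhdsWithin_le_nhds (s := Ioi (0 : ℝ)))
  -- Since `∫ ψ = 0`, the constant `1` may be subtracted from `|p|^{-ε}`; the division by `ε` is
  -- balanced by the pole of `rieszConst`. The quotient tends to the derivative of `|p|^{-ε}` at `ε
  -- = 0`.
  have hright : Tendsto (fun ε : ℝ => ∫ p, (((‖p‖ ^ (-ε) - 1) / ε : ℝ) : ℂ) * ψ p) (𝓝[>] 0)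
      (𝓝 (∫ p, ((-Real.log ‖p‖ : ℝ) : ℂ) * ψ p)) := by
    obtain ⟨L, hL⟩ := exists_isRegular_log_majorant (n := n)
    refine tendsto_integral_filter_of_dominated_convergence _
      (.of_forall fun ε => (Complex.measurable_ofReal.comp
        (((measurable_norm_rpow _).sub_const 1).div_const ε)).aestronglyMeasurable.mul
        ψ.continuous.aestronglyMeasurable) ?_ (hL ψ).1.norm ?_
    · filter_upwards [hε] with ε hε
      filter_upwards [ae_ne_zero] with x hx
      have hx0 : 0 < ‖x‖ := norm_pos_iff.2 hx
      rw [norm_mul, norm_mul, Complex.norm_real, Complex.norm_real,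
        Real.norm_of_nonneg (by positivity : 0 ≤ (2 + ‖x‖ ^ (-(1 / 2 : ℝ))) * |Real.log ‖x‖|),
        mul_comm]
      gcongr
      rw [norm_div, Real.norm_of_nonneg hε.1.le, div_le_iff₀ hε.1, Real.norm_eq_abs]
      have h1 := abs_exp_sub_one_le_mul (Real.log ‖x‖ * -ε)
      rw [← Real.rpow_def_of_pos hx0, abs_mul, abs_neg, abs_of_pos hε.1] at h1
      have h2 : ‖x‖ ^ (-ε) ≤ 1 + ‖x‖ ^ (-(1 / 2 : ℝ)) := by
        rcases le_total ‖x‖ 1 with h | h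
        · have := Real.rpow_le_rpow_of_exponent_ge hx0 h (show -(1 / 2 : ℝ) ≤ -ε by linarith)
          linarith
        · have := Real.rpow_le_one_of_one_le_of_nonpos h (show -ε ≤ 0 by linarith)
          have : 0 < ‖x‖ ^ (-(1 / 2 : ℝ)) := by positivity
          linarith
      refine h1.trans ?_
      have h3 : 0 ≤ |Real.log ‖x‖| * ε := mul_nonneg (abs_nonneg _) hε.1.le
      calc |Real.log ‖x‖| * ε * (1 + ‖x‖ ^ (-ε))
          ≤ |Real.log ‖x‖| * ε * (2 + ‖x‖ ^ (-(1 / 2 : ℝ))) :=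
            mul_le_mul_of_nonneg_left (by linarith) h3
        _ = _ := by ring
    · filter_upwards [ae_ne_zero] with x hx
      have hx0 : 0 < ‖x‖ := norm_pos_iff.2 hx
      have hd : HasDerivAt (fun ε : ℝ => ‖x‖ ^ (-ε)) (-Real.log ‖x‖) 0 := by
        have := (hasDerivAt_neg (0 : ℝ)).const_rpow hx0
        simpa using this
      have := (hasDerivAt_iff_tendsto_slope.1 hd).mono_left
        (nhdsWithin_mono (0 : ℝ) (fun y (hy : 0 < y) => hy.ne' : Ioi (0 : ℝ) ⊆ {0}ᶜ))
      refine ((Complex.continuous_ofReal.tendsto _).comp (this.congr fun ε => ?_)).mul_const _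
      simp [slope_def_field]
  have hlim := ((Complex.continuous_ofReal.tendsto _).comp
    (tendsto_mul_rieszConst (n := n))).mul hright
  refine (tendsto_nhds_unique (hleft.congr' ?_) hlim).trans ?_
  · filter_upwards [hε] with ε hε
    have hi := integrable_rpow_mul_schwartz hε.1.le (show ε < n by linarith) ψ
    rw [integral_rpow_mul_fourier hε.1 (by linarith)]
    have e : ∫ p, (((‖p‖ ^ (-ε) - 1) / ε : ℝ) : ℂ) * ψ p =
        (ε : ℂ)⁻¹ * ∫ p, ((‖p‖ ^ (-ε) : ℝ) : ℂ) * ψ p := by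
      rw [← sub_zero (∫ p, ((‖p‖ ^ (-ε) : ℝ) : ℂ) * ψ p), ← hψ, ← integral_sub hi ψ.integrable,
        ← integral_const_mul]
      congr 1 with p
      push_cast
      ring
    have : (ε : ℂ) ≠ 0 := by exact_mod_cast hε.1.ne'
    rw [e, Function.comp_apply]
    push_cast
    field_simp
  · rw [← mul_neg, ← integral_neg]
    simp

end LogKernel

/-! ### Assembly of the two singularity statements -/

section Main

variable {n : ℕ}

theorem integrableOn_closedBall_of_weight {g : Space n → ℂ} (hg : AEStronglyMeasurable g) {k : ℕ}
    (h : Integrable (fun y => ((1 + ‖y‖) ^ k)⁻¹ * ‖g y‖)) (R : ℝ) :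
    IntegrableOn g (closedBall 0 R) := by
  refine (h.integrableOn.const_mul ((1 + R) ^ k)).mono' hg.restrict ?_
  filter_upwards [ae_restrict_mem measurableSet_closedBall] with y hy
  have hy' : ‖y‖ ≤ R := by simpa using hy
  have h1 : 0 < (1 + ‖y‖) ^ k := by positivity
  rw [← mul_assoc, ← div_eq_mul_inv]
  refine le_mul_of_one_le_left (norm_nonneg _) ((one_le_div h1).2 ?_)
  gcongr

/-- `G W α` is the `L¹` function `G W (a + 1)` times a continuous power of `1 + |y|²`, which grows
at most polynomially. -/
theorem IsAlphaInf.exists_weight {W : Space n → ℂ} {a : ℝ} (h : IsAlphaInf W a) (α : ℝ) :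
    AEStronglyMeasurable (G W α) ∧
      ∃ k : ℕ, Integrable (fun y => ((1 + ‖y‖) ^ k)⁻¹ * ‖G W α y‖) := by
  have h0 : Integrable (G W (a + 1)) := h.1 _ (by linarith)
  have hpos : ∀ y : Space n, 0 < 1 + ‖y‖ ^ 2 := fun y => by positivity
  have e : ∀ y, G W α y = G W (a + 1) y * (((1 + ‖y‖ ^ 2) ^ ((a + 1 - α) / 2) : ℝ) : ℂ) := by
    intro y
    rw [G, G, mul_assoc, ← Complex.ofReal_mul, ← Real.rpow_add (hpos y)]
    congr 4
    ring
  have hcont : Continuous fun y : Space n => (1 + ‖y‖ ^ 2) ^ ((a + 1 - α) / 2) :=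
    (by fun_prop : Continuous fun y : Space n => 1 + ‖y‖ ^ 2).rpow_const
      fun y => .inl (hpos y).ne'
  have hm : AEStronglyMeasurable (G W α) := by
    rw [funext e]
    exact h0.1.mul (Complex.continuous_ofReal.comp hcont).aestronglyMeasurable
  refine ⟨hm, 2 * ⌈|(a + 1 - α) / 2|⌉₊, h0.norm.mono' ?_ (.of_forall fun y => ?_)⟩
  · refine (Continuous.aestronglyMeasurable ?_).mul hm.norm
    exact Continuous.inv₀ (by fun_prop) fun y => by positivity
  · have h1 : (1 + ‖y‖ ^ 2) ^ ((a + 1 - α) / 2) ≤ (1 + ‖y‖) ^ (2 * ⌈|(a + 1 - α) / 2|⌉₊) := by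
      calc (1 + ‖y‖ ^ 2) ^ ((a + 1 - α) / 2)
          ≤ (1 + ‖y‖ ^ 2) ^ ((⌈|(a + 1 - α) / 2|⌉₊ : ℕ) : ℝ) := by
            refine Real.rpow_le_rpow_of_exponent_le (by linarith [sq_nonneg ‖y‖]) ?_
            exact (le_abs_self _).trans (Nat.le_ceil _)
        _ = (1 + ‖y‖ ^ 2) ^ ⌈|(a + 1 - α) / 2|⌉₊ := Real.rpow_natCast _ _
        _ ≤ ((1 + ‖y‖) ^ 2) ^ ⌈|(a + 1 - α) / 2|⌉₊ := by
            gcongr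
            nlinarith [norm_nonneg y]
        _ = _ := (pow_mul _ _ _).symm
    have h2 : 0 < (1 + ‖y‖) ^ (2 * ⌈|(a + 1 - α) / 2|⌉₊) := by positivity
    rw [norm_mul, norm_inv, norm_norm, Real.norm_of_nonneg h2.le, e, norm_mul, Complex.norm_real,
      Real.norm_of_nonneg (by positivity [hpos y]), inv_mul_le_iff₀ h2, mul_comm]
    gcongr

theorem exists_schwartz_integral_eq_one (n : ℕ) : ∃ φ : 𝓢(Space n, ℂ), ∫ p, φ p = 1 := by
  let b : ContDiffBump (0 : Space n) := ⟨1, 2, one_pos, one_lt_two⟩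
  have h1 : HasCompactSupport fun x => ((b.normed volume x : ℝ) : ℂ) :=
    (b.hasCompactSupport_normed (μ := volume)).comp_left Complex.ofReal_zero
  have h2 : ContDiff ℝ (⊤ : ℕ∞) fun x => ((b.normed volume x : ℝ) : ℂ) :=
    Complex.ofRealCLM.contDiff.comp b.contDiff_normed
  refine ⟨h1.toSchwartzMap h2, ?_⟩
  simp only [HasCompactSupport.toSchwartzMap_toFun]
  rw [integral_complex_ofReal, b.integral_normed, Complex.ofReal_one]

variable [NeZero n]

theorem hasPowerSingularity_fourier {g : Space n → ℂ} {T : 𝓢'(Space n, ℂ)} {ε : ℝ} {c : ℂ}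
    (h0 : 0 < ε) (h1 : ε < n) (hgm : AEStronglyMeasurable g)
    (hloc : ∀ R, IntegrableOn g (closedBall 0 R)) (htail : HasPowerTail g (n - ε) c)
    (hT : IsRegular T g) : HasPowerSingularity (𝓕 T) ε (rieszConst n ε * c) := by
  obtain ⟨U, hU⟩ := exists_isRegular_rpow (n := n) h0 h1 (rieszConst n ε * c)
  refine ⟨U, hU, PointwiseConvergenceCLM.tendsto_iff_forall_tendsto.2 fun φ => ?_⟩
  obtain ⟨B, hB, hφB⟩ := exists_pow_mul_norm_le (𝓕 φ) 0
  simp only [pow_zero, one_mul] at hφB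
  have hε : ∀ r : ℝ, r ^ ((n : ℝ) - (n - ε)) = r ^ ε := fun r => by rw [sub_sub_cancel]
  have hr0 : Tendsto (fun r : ℝ => ((r ^ ε : ℝ) : ℂ)) (𝓝[>] 0) (𝓝 0) := by
    have := (Complex.continuous_ofReal.comp
      (Real.continuous_rpow_const h0.le)).tendsto 0
    simp only [Function.comp_apply, Real.zero_rpow h0.ne', Complex.ofReal_zero] at this
    exact this.mono_left nhdsWithin_le_nhds
  have := tendsto_scaling hgm hloc htail (by linarith) (𝓕 φ).continuous hφB
    (integrable_rpow_mul_schwartz (by linarith) (by linarith) _) (fun y => by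
      simp only [hε]
      have h2 : Tendsto (fun r : ℝ => (𝓕 φ) (r • y)) (𝓝[>] 0) (𝓝 ((𝓕 φ) ((0 : ℝ) • y))) :=
        ((by fun_prop : Continuous fun r : ℝ => (𝓕 φ) (r • y)).tendsto 0).mono_left
          nhdsWithin_le_nhds
      simpa using hr0.mul h2)
  have hval : U φ = c * ∫ x, ((‖x‖ ^ (-(n - ε)) : ℝ) : ℂ) * (𝓕 φ) x := by
    rw [(hU φ).2, integral_rpow_mul_fourier h0 h1, ← integral_const_mul, ← integral_const_mul]
    congr 1 with p
    ring
  rw [hval]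
  refine this.congr' ?_
  filter_upwards [self_mem_nhdsWithin] with r hr
  rw [hε, ← dilate_fourier_apply hT hr]
  rfl

theorem hasLogSingularity_fourier {g : Space n → ℂ} {T : 𝓢'(Space n, ℂ)} {c : ℂ}
    (hgm : AEStronglyMeasurable g)
    (hloc : ∀ R, IntegrableOn g (closedBall 0 R)) (htail : HasPowerTail g n c)
    (hT : IsRegular T g) : HasLogSingularity (𝓕 T) (sphereArea n * c) := by
  obtain ⟨L, hL⟩ := exists_isRegular_log (n := n) (-(sphereArea n * c))
  obtain ⟨φ₀, hφ₀⟩ := exists_schwartz_integral_eq_one n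
  let J : 𝓢(Space n, ℂ) → ℂ := fun φ => ∫ p, ((Real.log ‖p‖ : ℝ) : ℂ) * φ p
  have hJL : ∀ φ, L φ = -(sphereArea n * c) * J φ := fun φ => by
    rw [(hL φ).2, ← integral_const_mul]
    congr 1 with p
    ring
  have hfourier0 : ∀ φ : 𝓢(Space n, ℂ), (𝓕 φ) 0 = ∫ p, φ p := fun φ => by
    rw [SchwartzMap.fourier_coe, Real.fourier_eq]
    simp
  -- This `b(r)` makes the claimed limit an exact equality on `φ₀` for every `r > 0`, because `∫ φ₀
  -- = 1`.
  refine ⟨L, fun r => dilate r (𝓕 T) φ₀ + sphereArea n * c * J φ₀, hL, ?_, ?_⟩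
  · obtain ⟨C₀, hC₀, h0⟩ := exists_pow_mul_norm_le (𝓕 φ₀) 0
    obtain ⟨C₁, hC₁, h1⟩ := exists_pow_mul_norm_le (𝓕 φ₀) 1
    obtain ⟨C₂, hC₂, h2⟩ := exists_norm_sub_le_mul_norm (𝓕 φ₀)
    rw [hfourier0, hφ₀] at h2
    simp only [pow_zero, one_mul, pow_one] at h0 h1
    have hlim := tendsto_div_log (C := C₀ + C₁ + C₂) hgm hloc htail (𝓕 φ₀).continuous
      (fun x => (h0 x).trans (by linarith))
      (fun x => (h2 x).trans (by gcongr; linarith)) (fun x => (h1 x).trans (by linarith))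
    have hlog : Tendsto (fun r : ℝ => ((Real.log r⁻¹ : ℝ) : ℂ)⁻¹) (𝓝[>] 0) (𝓝 0) := by
      have : Tendsto (fun r : ℝ => (((Real.log r⁻¹)⁻¹ : ℝ) : ℂ)) (𝓝[>] 0) (𝓝 ((0 : ℝ) : ℂ)) :=
        (Complex.continuous_ofReal.tendsto 0).comp (tendsto_inv_atTop_zero.comp
          (Real.tendsto_log_atTop.comp tendsto_inv_nhdsGT_zero))
      simpa only [Complex.ofReal_inv, Complex.ofReal_zero] using this
    have := hlim.add (hlog.const_mul (sphereArea n * c * J φ₀))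
    rw [mul_zero, add_zero] at this
    refine this.congr' ?_
    filter_upwards [self_mem_nhdsWithin] with r hr
    rw [← dilate_fourier_apply hT hr, add_div, ← div_eq_mul_inv]
  · refine PointwiseConvergenceCLM.tendsto_iff_forall_tendsto.2 fun φ => ?_
    let m : ℂ := ∫ p, φ p
    -- The mean-zero part of `φ`: its transform vanishes at the origin, so the scaling limit with `s
    -- = n` applies.
    let ψ : 𝓢(Space n, ℂ) := φ - m • φ₀
    have hψ : ∫ p, ψ p = 0 := by
      have : ∀ p, ψ p = φ p - m * φ₀ p := fun p => rfl
      simp_rw [this]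
      rw [integral_sub φ.integrable (φ₀.integrable.const_mul m), integral_const_mul, hφ₀, mul_one,
        sub_self]
    have hψ0 : (𝓕 ψ) 0 = 0 := (hfourier0 ψ).trans hψ
    obtain ⟨B, hB, hψB⟩ := exists_pow_mul_norm_le (𝓕 ψ) 0
    simp only [pow_zero, one_mul] at hψB
    have hint : Integrable fun x => ((‖x‖ ^ (-(n : ℝ)) : ℝ) : ℂ) * (𝓕 ψ) x := by
      refine (integrable_rpow_neg_natCast_mul_schwartz hψ0).mono
        ((Complex.measurable_ofReal.comp (measurable_norm_rpow _)).aestronglyMeasurable.mul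
          (𝓕 ψ).continuous.aestronglyMeasurable) (.of_forall fun x => ?_)
      rw [norm_mul, norm_mul, Complex.norm_real, Complex.norm_real,
        Real.norm_of_nonneg (by positivity), Real.norm_of_nonneg (by positivity)]
      gcongr
      exact le_mul_of_one_le_right (by positivity) (by linarith [norm_nonneg x])
    have hlim := tendsto_scaling hgm hloc htail le_rfl (𝓕 ψ).continuous hψB hint (fun y => by
      have h2 : Tendsto (fun r : ℝ => (𝓕 ψ) (r • y)) (𝓝[>] 0) (𝓝 ((𝓕 ψ) ((0 : ℝ) • y))) :=
        ((by fun_prop : Continuous fun r : ℝ => (𝓕 ψ) (r • y)).tendsto 0).mono_left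
          nhdsWithin_le_nhds
      simpa [hψ0] using h2)
    rw [integral_rpow_neg_mul_fourier hψ] at hlim
    -- Linearity of `J` is inherited from the tempered distribution of `log |p|`, which already
    -- contains the integrability.
    have hJ : J ψ + m * J φ₀ = J φ := by
      obtain ⟨L₁, hL₁⟩ := exists_isRegular_log (n := n) 1
      have e : ∀ φ, J φ = L₁ φ := fun φ => by
        rw [(hL₁ φ).2]
        refine integral_congr_ae (.of_forall fun p => ?_)
        simp [mul_comm]
      simp only [e, ψ, map_sub, map_smul, smul_eq_mul]
      ring
    have h3 := hlim.sub_const (m * (sphereArea n * c * J φ₀))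
    have h4 : c * -(sphereArea n * J ψ) - m * (sphereArea n * c * J φ₀) = L φ := by
      rw [hJL, ← hJ]
      ring
    rw [← h4]
    refine h3.congr' ?_
    filter_upwards [self_mem_nhdsWithin] with r hr
    have h5 : dilate r (𝓕 T) ψ = dilate r (𝓕 T) φ - m * dilate r (𝓕 T) φ₀ := by
      simp only [ψ, map_sub, map_smul, smul_eq_mul]
    rw [← dilate_fourier_apply hT hr, h5]
    change _ = dilate r (𝓕 T) φ - (dilate r (𝓕 T) φ₀ + sphereArea n * c * J φ₀) *
      (volume.toTemperedDistribution : 𝓢'(Space n, ℂ)) φ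
    rw [show (volume.toTemperedDistribution : 𝓢'(Space n, ℂ)) φ = m by
      simp [m, Measure.toTemperedDistribution_apply]]
    simp
    ring

end Main

end ScalingLimit

theorem mainTheorem8 (n : ℕ) (hn : 0 < n) :
    (∀ ε : ℝ, 0 < ε → ε < n →
      ∃ K : ℝ, 0 < K ∧
        ∀ (W : ScalingLimit.Space n → ℂ) (αinf α : ℝ) (c : ℂ),
          ScalingLimit.IsAlphaInf W αinf → αinf - α = ε → c ≠ 0 →
          ScalingLimit.HasPowerTail (ScalingLimit.G W α) (n - ε) c →
          ∃ T : 𝓢'(ScalingLimit.Space n, ℂ),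
            ScalingLimit.IsRegular T (ScalingLimit.G W α) ∧
            ScalingLimit.HasPowerSingularity (𝓕 T) ε (K * c)) ∧
    (∃ K : ℝ, 0 < K ∧
      ∀ (W : ScalingLimit.Space n → ℂ) (αinf : ℝ) (c : ℂ),
        ScalingLimit.IsAlphaInf W αinf → c ≠ 0 →
        ScalingLimit.HasPowerTail (ScalingLimit.G W αinf) n c →
        ∃ T : 𝓢'(ScalingLimit.Space n, ℂ),
          ScalingLimit.IsRegular T (ScalingLimit.G W αinf) ∧
          ScalingLimit.HasLogSingularity (𝓕 T) (K * c)) := by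
  have : NeZero n := ⟨hn.ne'⟩
  refine ⟨fun ε h0 h1 => ⟨ScalingLimit.rieszConst n ε, ScalingLimit.rieszConst_pos h0 h1, ?_⟩,
    ScalingLimit.sphereArea n, ScalingLimit.sphereArea_pos, ?_⟩
  · intro W αinf α c hW _ _ htail
    obtain ⟨hm, k, hk⟩ := hW.exists_weight α
    obtain ⟨T, hT⟩ := ScalingLimit.exists_isRegular hm k hk
    exact ⟨T, hT, ScalingLimit.hasPowerSingularity_fourier h0 h1 hm
      (ScalingLimit.integrableOn_closedBall_of_weight hm hk) htail hT⟩
  · intro W αinf c hW _ htail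
    obtain ⟨hm, k, hk⟩ := hW.exists_weight αinf
    obtain ⟨T, hT⟩ := ScalingLimit.exists_isRegular hm k hk
    exact ⟨T, hT, ScalingLimit.hasLogSingularity_fourier hm
      (ScalingLimit.integrableOn_closedBall_of_weight hm hk) htail hT⟩
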